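/- Let $b,c\in C[0,1]$ and $\lambda,a_1,a_2,a_3,a_4\in C([0,1]^2)$ be non-negative and let $\phi\in C[0,1]$. For $N\ge 1$ let $(X^N_t)_{t\ge 0}$ be the continuous-time Markov process on $[0,\infty)^N$ with generator $$\mathcal L_Nf(x)=\sum_{i=1}^N b\left(\tfrac iN\right)\big(f(x^{i,+})-f(x)\big)+\frac1N\sum_{i=1}^N\sum_{j\ne i}\lambda\left(\tfrac iN,\tfrac jN\right)\big(f(x^{(i,j)})-f(x)\big),$$ where $x^{i,+}$ is obtained from $x$ by replacing $x(i)$ by $c(\frac iN)x(i)$, and $x^{(i,j)}$ is obtained from $x$ by replacing $x(i)$ by $a_1x(i)+a_2x(j)$ and $x(j)$ by $a_3x(i)+a_4x(j)$, with $a_1,\dots,a_4$ evaluated at $(\frac iN,\frac jN)$. Assume that $X^N_0(1),\dots,X^N_0(N)$ are independent with $P(X^N_0(i)=1)=\phi(\frac iN)=1-P(X^N_0(i)=0)$ for each $i$. Equip $C[0,1]$ with the supremum norm and its dual $(C[0,1])'$ with the dual norm. Let $\rho:[0,\infty)\to C[0,1]$ be the unique solution of $\rho(0,\cdot)=\phi$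 and $$\frac{d}{dt}\rho(t,u)=\Big(b(u)(c(u)-1)+\int_0^1\lambda(v,u)(a_4(v,u)-1)dv+\int_0^1\lambda(u,v)(a_1(u,v)-1)dv\Big)\rho(t,u)+\int_0^1\big(\lambda(u,v)a_2(u,v)+\lambda(v,u)a_3(v,u)\big)\rho(t,v)dv$$ (as an ordinary differential equation in $C[0,1]$). For $f\in C[0,1]$ put $$P_2f(u)=(c^2(u)-1)b(u)f(u)+f(u)\int_0^1\lambda(u,v)(a_1^2(u,v)-1)dv+\int_0^1\lambda(v,u)a_2^2(v,u)f(v)dv+\int_0^1\lambda(u,v)a_3^2(u,v)f(v)dv+f(u)\int_0^1\lambda(v,u)(a_4^2(v,u)-1)dv,$$ $$l_{1,t}(f)=2\int_0^1\!\!\int_0^1\rho(t,u)\rho(t,v)\big(a_1(u,v)a_2(u,v)\lambda(u,v)+\lambda(v,u)a_3(v,u)a_4(v,u)\big)f(u)\,du\,dv,$$ and let $P_2^*$ be the adjoint of $P_2$, $(P_2^*\nu)(f)=\nu(P_2f)$ for $\nu\in(C[0,1])'$. Let $T>0$. Then the $(C[0,1])'$-valued ordinary differential equation $$\frac{d}{dt}\theta_t=P_2^*\theta_t+l_{1,t}\quad(0\le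 t\le T),\qquad \theta_0(du)=\phi(u)\,du,$$ has a unique solution $(\theta_t)_{0\le t\le T}$, and, with $\theta^N_t=\frac1N\sum_{i=1}^N(X^N_t(i))^2\delta_{i/N}$, $$\lim_{N\to\infty}\ \sup_{0\le t\le T}\mathbb E\Big(\big(\theta^N_t(H_t)-\theta_t(H_t)\big)^2\Big)=0\qquad\text{for every }H\in C([0,T]\times[0,1]),$$ where $H_t=H(t,\cdot)$. Furthermore, there exists $\vartheta\in C([0,T]\times[0,1])$ such that $\theta_t(du)=\vartheta(t,u)\,du$ for all $0\le t\le T$. -/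

import Mathlib

open MeasureTheory ProbabilityTheory Filter Topology unitInterval
open scoped NNReal ENNReal BoundedContinuousFunction

noncomputable section

namespace NUrn

/-- The parameters of the model: `b, c ∈ C[0,1]` and `λ, a₁, a₂, a₃, a₄ ∈ C([0,1] × [0,1])`,
all of them non-negative. -/
structure Coeffs where
  b : C(I, ℝ≥0)
  c : C(I, ℝ≥0)
  lam : C(I × I, ℝ≥0)
  a₁ : C(I × I, ℝ≥0)
  a₂ : C(I × I, ℝ≥0)
  a₃ : C(I × I, ℝ≥0)
  a₄ : C(I × I, ℝ≥0)

/-- A non-negative continuous function, seen as a real-valued one. -/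
def toR {Y : Type*} [TopologicalSpace Y] (g : C(Y, ℝ≥0)) : C(Y, ℝ) :=
  ⟨fun y => (g y : ℝ), by fun_prop⟩

/-! ### The process -/

/-- The state space `[0, ∞)^N`. The urn called `i` in the usual numbering `1, …, N` is the index
`i - 1 : Fin N`. -/
abbrev State (N : ℕ) : Type := Fin N → ℝ≥0

/-- The position `i / N ∈ [0,1]` of the `i`-th urn (`i = 1, …, N`). -/
def pos {N : ℕ} (i : Fin N) : I :=
  ⟨((i : ℝ) + 1) / N, by
    have hi : (i : ℝ) + 1 ≤ N := by exact_mod_cast i.isLt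
    constructor
    · positivity
    · exact div_le_one_of_le₀ hi (by positivity)⟩

/-- The state `x^{i,+}`: the `i`-th coordinate of `x` is multiplied by `c(i/N)`. -/
def jumpSite (M : Coeffs) {N : ℕ} (i : Fin N) (x : State N) : State N :=
  fun k => if k = i then M.c (pos i) * x i else x k

/-- The state `x^{(i,j)}`: the pair `(x(i), x(j))` undergoes the linear transformation with
entries `a₁, a₂, a₃, a₄` at `(i/N, j/N)`. -/
def jumpPair (M : Coeffs) {N : ℕ} (i j : Fin N) (x : State N) : State N :=
  fun k =>
    if k = i then M.a₁ (pos i, pos j) * x i + M.a₂ (pos i, pos j) * x j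
    else if k = j then M.a₃ (pos i, pos j) * x i + M.a₄ (pos i, pos j) * x j
    else x k

theorem continuous_jumpSite (M : Coeffs) {N : ℕ} (i : Fin N) :
    Continuous (jumpSite M i : State N → State N) := by
  refine continuous_pi fun k => ?_
  unfold jumpSite
  split_ifs <;> fun_prop

theorem continuous_jumpPair (M : Coeffs) {N : ℕ} (i j : Fin N) :
    Continuous (jumpPair M i j : State N → State N) := by
  refine continuous_pi fun k => ?_
  unfold jumpPair
  split_ifs <;> fun_prop

/-- Composition `f ↦ f ∘ g` as a bounded operator on bounded continuous functions. -/
def pullback {Y : Type*} [TopologicalSpace Y] (g : C(Y, Y)) : (Y →ᵇ ℝ) →L[ℝ] (Y →ᵇ ℝ) where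
  toFun f := f.compContinuous g
  map_add' _ _ := rfl
  map_smul' _ _ := rfl
  cont := BoundedContinuousFunction.continuous_compContinuous g

/-- The generator of the `N`-urn linear system. Since the total jump rate is bounded, it is
a bounded operator on the bounded continuous functions on `[0, ∞)^N`; see `generator_apply`. -/
def generator (M : Coeffs) (N : ℕ) : (State N →ᵇ ℝ) →L[ℝ] (State N →ᵇ ℝ) :=
  (∑ i : Fin N, (M.b (pos i) : ℝ) • (pullback ⟨jumpSite M i, continuous_jumpSite M i⟩ - 1)) +
    (1 / N : ℝ) • ∑ i : Fin N, ∑ j ∈ Finset.univ.filter (fun j => j ≠ i),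
      (M.lam (pos i, pos j) : ℝ) • (pullback ⟨jumpPair M i j, continuous_jumpPair M i j⟩ - 1)

theorem generator_apply (M : Coeffs) (N : ℕ) (f : State N →ᵇ ℝ) (x : State N) :
    generator M N f x =
      ∑ i : Fin N, (M.b (pos i) : ℝ) * (f (jumpSite M i x) - f x) +
      (1 / N : ℝ) * ∑ i : Fin N, ∑ j ∈ Finset.univ.filter (fun j => j ≠ i),
        (M.lam (pos i, pos j) : ℝ) * (f (jumpPair M i j x) - f x) := by
  have h : ∀ g : C(State N, State N), pullback g f x = f (g x) := fun _ => rfl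
  simp [generator, h, BoundedContinuousFunction.coe_sum]


/-- The exponential `exp A = ∑ Aⁿ / n!` of a bounded operator `A` on a Banach space. -/
def opExp {E : Type*} [NormedAddCommGroup E] [NormedSpace ℝ E] (A : E →L[ℝ] E) : E →L[ℝ] E :=
  NormedSpace.exp A

/-- The transition semigroup `S(t) = exp(t L)` of the Markov process with generator `L`. -/
def semigroup (M : Coeffs) (N : ℕ) (t : ℝ≥0) : (State N →ᵇ ℝ) →L[ℝ] (State N →ᵇ ℝ) :=
  opExp ((t : ℝ) • generator M N)

/-- The `σ`-algebra generated by `X r`, `r ≤ s`. -/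
@[reducible]
def past {Ω E : Type*} [MeasurableSpace E] (X : ℝ≥0 → Ω → E) (s : ℝ≥0) : MeasurableSpace Ω :=
  ⨆ r : Set.Iic s, MeasurableSpace.comap (X r) inferInstance

/-- `X` is (a version of) the `N`-urn linear system under the probability measure `P`: a process
with càdlàg paths which is Markov with the transition semigroup generated by `generator M N`. -/
structure IsLinearSystem (M : Coeffs) (N : ℕ) {Ω : Type*} [MeasurableSpace Ω] (P : Measure Ω)
    (X : ℝ≥0 → Ω → State N) : Prop where
  measurable : ∀ t, Measurable (X t)
  cadlag : ∀ᵐ ω ∂P, ∀ t, ContinuousWithinAt (fun s => X s ω) (Set.Ici t) t ∧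
    ∃ l, Tendsto (fun s => X s ω) (𝓝[<] t) (𝓝 l)
  markov : ∀ (s t : ℝ≥0) (f : State N →ᵇ ℝ),
    P[fun ω => f (X (s + t) ω) | past X s] =ᵐ[P] fun ω => semigroup M N t f (X s ω)

/-- The initial state: independent coordinates, the `i`-th being `1` with probability `φ(i/N)` and
`0` with probability `1 - φ(i/N)`. (So `0 ≤ φ(i/N) ≤ 1` necessarily.) -/
structure IsInitialState (φ : C(I, ℝ)) (N : ℕ) {Ω : Type*} [MeasurableSpace Ω] (P : Measure Ω)
    (X₀ : Ω → State N) : Prop where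
  indep : iIndepFun (fun (i : Fin N) ω => X₀ ω i) P
  prob_one : ∀ i : Fin N, P.real {ω | X₀ ω i = 1} = φ (pos i)
  prob_zero : ∀ i : Fin N, P.real {ω | X₀ ω i = 0} = 1 - φ (pos i)

/-- `θ^N = (1/N) ∑ᵢ x(i)² δ_{i/N}` for a state `x`, as an element of the dual of `C[0,1]`. -/
def sqEmpirical {N : ℕ} (x : State N) : StrongDual ℝ C(I, ℝ) :=
  (1 / N : ℝ) • ∑ i : Fin N, ((x i : ℝ) ^ 2) • ContinuousMap.evalCLM ℝ (pos i)

theorem sqEmpirical_apply {N : ℕ} (x : State N) (f : C(I, ℝ)) :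
    sqEmpirical x f = (1 / N : ℝ) * ∑ i : Fin N, (x i : ℝ) ^ 2 * f (pos i) := by
  simp [sqEmpirical, ContinuousMap.evalCLM]

/-! ### The limiting equations -/

theorem integrable_C (f : C(I, ℝ)) : Integrable f (volume : Measure I) :=
  f.continuous.integrable_of_hasCompactSupport (HasCompactSupport.of_compactSpace f)

theorem abs_integral_C_le (f : C(I, ℝ)) : |∫ v, f v| ≤ ‖f‖ := by
  have h := norm_integral_le_of_norm_le_const (μ := (volume : Measure I))
    (Eventually.of_forall fun v => f.norm_coe_le_norm v)
  simpa using h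

/-- The functional `f ↦ ∫₀¹ f(u) du` on `C[0,1]`. -/
def integralFunctional : StrongDual ℝ C(I, ℝ) :=
  LinearMap.mkContinuous
    { toFun := fun f => ∫ u, f u
      map_add' := fun f g => integral_add (integrable_C f) (integrable_C g)
      map_smul' := fun r f => integral_const_mul r f } 1
    (fun f => by simpa using abs_integral_C_le f)

/-- Multiplication by `g`, as a bounded operator on `C[0,1]`. -/
def mulOp (g : C(I, ℝ)) : C(I, ℝ) →L[ℝ] C(I, ℝ) := ContinuousLinearMap.mul ℝ C(I, ℝ) g

/-- The measure `g(u) du`, as an element of the dual of `C[0,1]`. -/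
def densityFunctional (g : C(I, ℝ)) : StrongDual ℝ C(I, ℝ) :=
  integralFunctional.comp (mulOp g)

theorem densityFunctional_apply (g f : C(I, ℝ)) :
    densityFunctional g f = ∫ u, g u * f u := rfl

/-- The integral operator `f ↦ ∫₀¹ k(·, v) f(v) dv` on `C[0,1]`. -/
def kernelOp (k : C(I × I, ℝ)) : C(I, ℝ) →L[ℝ] C(I, ℝ) :=
  LinearMap.mkContinuous
    { toFun := fun f => ⟨fun u => integralFunctional (k.curry u * f),
        integralFunctional.continuous.comp (k.curry.continuous.mul continuous_const)⟩
      map_add' := fun f g => by ext u; simp [mul_add]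
      map_smul' := fun r f => by ext u; simp } ‖k‖
    (fun f => by
      refine (ContinuousMap.norm_le _ (by positivity)).2 fun u => ?_
      refine (abs_integral_C_le (k.curry u * f)).trans ((norm_mul_le _ _).trans ?_)
      refine mul_le_mul_of_nonneg_right ?_ (norm_nonneg f)
      exact (ContinuousMap.norm_le _ (norm_nonneg k)).2 fun v => k.norm_coe_le_norm (u, v))

theorem kernelOp_apply (k : C(I × I, ℝ)) (f : C(I, ℝ)) (u : I) :
    kernelOp k f u = ∫ v, k (u, v) * f v := rfl

/-- The kernel `(u, v) ↦ k(v, u)`. -/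
def swapK (k : C(I × I, ℝ)) : C(I × I, ℝ) := k.comp ⟨Prod.swap, continuous_swap⟩

/-- The bounded operator on `C[0,1]` which drives the density `ρ(t, ·)` of the hydrodynamic limit;
see `hydroOp_apply`. -/
def hydroOp (M : Coeffs) : C(I, ℝ) →L[ℝ] C(I, ℝ) :=
  mulOp (toR M.b * (toR M.c - 1)) +
    mulOp (kernelOp (swapK (toR M.lam * (toR M.a₄ - 1))) 1) +
    mulOp (kernelOp (toR M.lam * (toR M.a₁ - 1)) 1) +
    kernelOp (toR M.lam * toR M.a₂) +
    kernelOp (swapK (toR M.lam * toR M.a₃))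

theorem hydroOp_apply (M : Coeffs) (f : C(I, ℝ)) (u : I) :
    hydroOp M f u =
      (M.b u : ℝ) * (M.c u - 1) * f u
      + f u * (∫ v, (M.lam (v, u) : ℝ) * (M.a₄ (v, u) - 1))
      + f u * (∫ v, (M.lam (u, v) : ℝ) * (M.a₁ (u, v) - 1))
      + (∫ v, (M.lam (u, v) : ℝ) * M.a₂ (u, v) * f v)
      + (∫ v, (M.lam (v, u) : ℝ) * M.a₃ (v, u) * f v) := by
  simp [hydroOp, mulOp, kernelOp_apply, toR, swapK, mul_comm (f u)]

/-- `ρ : [0, ∞) → C[0,1]` solves the linear equation `dρ/dt = hydroOp ρ`, `ρ(0, ·) = φ`, in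
`C[0,1]` with the supremum norm (values of `ρ` at negative times are irrelevant). -/
def IsHydroDensity (M : Coeffs) (φ : C(I, ℝ)) (ρ : ℝ → C(I, ℝ)) : Prop :=
  ρ 0 = φ ∧ ∀ t, 0 ≤ t → HasDerivWithinAt ρ (hydroOp M (ρ t)) (Set.Ici 0) t

/-- `P₃ f(u) = (c²(u) - 1) b(u) f(u)`. -/
def P₃ (M : Coeffs) : C(I, ℝ) →L[ℝ] C(I, ℝ) := mulOp ((toR M.c ^ 2 - 1) * toR M.b)

/-- `P₄ f(u) = f(u) ∫ λ(u,v) (a₁²(u,v) - 1) dv`. -/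
def P₄ (M : Coeffs) : C(I, ℝ) →L[ℝ] C(I, ℝ) :=
  mulOp (kernelOp (toR M.lam * (toR M.a₁ ^ 2 - 1)) 1)

/-- `P₅ f(u) = ∫ λ(v,u) a₂²(v,u) f(v) dv`. -/
def P₅ (M : Coeffs) : C(I, ℝ) →L[ℝ] C(I, ℝ) := kernelOp (swapK (toR M.lam * toR M.a₂ ^ 2))

/-- `P₆ f(u) = ∫ λ(u,v) a₃²(u,v) f(v) dv`. -/
def P₆ (M : Coeffs) : C(I, ℝ) →L[ℝ] C(I, ℝ) := kernelOp (toR M.lam * toR M.a₃ ^ 2)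

/-- `P₇ f(u) = f(u) ∫ λ(v,u) (a₄²(v,u) - 1) dv`. -/
def P₇ (M : Coeffs) : C(I, ℝ) →L[ℝ] C(I, ℝ) :=
  mulOp (kernelOp (swapK (toR M.lam * (toR M.a₄ ^ 2 - 1))) 1)

/-- `P₂ = P₃ + P₄ + P₅ + P₆ + P₇`. -/
def P₂ (M : Coeffs) : C(I, ℝ) →L[ℝ] C(I, ℝ) := P₃ M + P₄ M + P₅ M + P₆ M + P₇ M

theorem P₂_apply (M : Coeffs) (f : C(I, ℝ)) (u : I) :
    P₂ M f u =
      ((M.c u : ℝ) ^ 2 - 1) * M.b u * f u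
      + f u * (∫ v, (M.lam (u, v) : ℝ) * ((M.a₁ (u, v) : ℝ) ^ 2 - 1))
      + (∫ v, (M.lam (v, u) : ℝ) * (M.a₂ (v, u) : ℝ) ^ 2 * f v)
      + (∫ v, (M.lam (u, v) : ℝ) * (M.a₃ (u, v) : ℝ) ^ 2 * f v)
      + f u * (∫ v, (M.lam (v, u) : ℝ) * ((M.a₄ (v, u) : ℝ) ^ 2 - 1)) := by
  simp [P₂, P₃, P₄, P₅, P₆, P₇, mulOp, kernelOp_apply, toR, swapK, mul_comm (f u)]

/-- The adjoint `A^*` of a bounded operator `A` on `C[0,1]`: `(A^* ν)(f) = ν(A f)`. -/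
def adj (A : C(I, ℝ) →L[ℝ] C(I, ℝ)) (ν : StrongDual ℝ C(I, ℝ)) : StrongDual ℝ C(I, ℝ) :=
  ν.comp A

/-- The functional `l₁`, where `r = ρ(t, ·)`; see `lOne_apply`. -/
def lOne (M : Coeffs) (r : C(I, ℝ)) : StrongDual ℝ C(I, ℝ) :=
  (2 : ℝ) • densityFunctional (r * kernelOp (toR M.a₁ * toR M.a₂ * toR M.lam) r) +
    (2 : ℝ) • densityFunctional (r * kernelOp (swapK (toR M.lam * toR M.a₃ * toR M.a₄)) r)

theorem lOne_apply (M : Coeffs) (r f : C(I, ℝ)) :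
    lOne M r f =
      2 * (∫ u, ∫ v, r u * r v * M.a₁ (u, v) * M.a₂ (u, v) * M.lam (u, v) * f u)
      + 2 * (∫ u, ∫ v, M.lam (v, u) * M.a₃ (v, u) * M.a₄ (v, u) * r u * r v * f u) := by
  simp only [lOne, add_apply, smul_apply, smul_eq_mul,
    densityFunctional_apply, ContinuousMap.mul_apply, kernelOp_apply, ← integral_const_mul,
    ← integral_mul_const]
  congr 1
  · refine integral_congr_ae (Eventually.of_forall fun u => ?_)
    refine integral_congr_ae (Eventually.of_forall fun v => ?_)
    simp only [toR, ContinuousMap.coe_mk]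
    ring
  · refine integral_congr_ae (Eventually.of_forall fun u => ?_)
    refine integral_congr_ae (Eventually.of_forall fun v => ?_)
    simp only [toR, swapK, ContinuousMap.coe_mk, ContinuousMap.comp_apply,
      ContinuousMap.mul_apply, Prod.swap_prod_mk]
    ring

/-- `θ : [0, T] → C[0,1]'` solves `dθ/dt = P₂^* θ + l_{1,t}` for `0 ≤ t ≤ T`, `θ₀ = φ(u) du`, in
the dual of `C[0,1]` with the dual norm (values of `θ` outside `[0, T]` are irrelevant). -/
def IsThetaSolution (M : Coeffs) (φ : C(I, ℝ)) (ρ : ℝ → C(I, ℝ)) (T : ℝ)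
    (θ : ℝ → StrongDual ℝ C(I, ℝ)) : Prop :=
  θ 0 = densityFunctional φ ∧
    ∀ t ∈ Set.Icc 0 T,
      HasDerivWithinAt θ (adj (P₂ M) (θ t) + lOne M (ρ t)) (Set.Icc 0 T) t

end NUrn

end

/-! For fixed `f`, the generator maps the average `Y(f)` of `f(i/N) x(i)^p` to `Y(A f)` plus an
error of order `1/N` and, when `p = 2`, a double sum of mixed products `x(i) x(j)`; the carré du
champ of `Y(f)` is also of order `1/N`. Testing against the backward flow `s ↦ exp((t - s) A) f`
cancels `Y(A f)`. Dynkin's formula for the square of the deviation from the limit functional,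
together with Grönwall's inequality, then gives an `L²` law of large numbers, uniform for `f` in a
compact set, as soon as the double sum has a limit. For `p = 1` it is absent. For `p = 2` the
case `p = 1` lets one replace the inner sum over `j` by its limit; the error is a product of the
average `Z` of `x(i)²` and a small fluctuation, which are separated by `Z ≤ ζ⁻¹ + ζ Z²` and moment
bounds. Since the observables are unbounded, Dynkin's formula is proved for functions of
polynomial growth by truncation. -/

noncomputable section

namespace NUrn

/-- `M.BoundedBy K`: all the parameters of the model are at most `K`, and `1 ≤ K`, so that powers
of `K` increase. -/
structure Coeffs.BoundedBy (M : Coeffs) (K : ℝ) : Prop where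
  one_le : 1 ≤ K
  b_le : ∀ u, (M.b u : ℝ) ≤ K
  c_le : ∀ u, (M.c u : ℝ) ≤ K
  lam_le : ∀ z, (M.lam z : ℝ) ≤ K
  a₁_le : ∀ z, (M.a₁ z : ℝ) ≤ K
  a₂_le : ∀ z, (M.a₂ z : ℝ) ≤ K
  a₃_le : ∀ z, (M.a₃ z : ℝ) ≤ K
  a₄_le : ∀ z, (M.a₄ z : ℝ) ≤ K

theorem Coeffs.exists_boundedBy (M : Coeffs) : ∃ K, M.BoundedBy K := by
  have bound {Y : Type} [TopologicalSpace Y] [CompactSpace Y] (g : C(Y, ℝ≥0)) :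
      ∀ᶠ K in atTop, ∀ y, (g y : ℝ) ≤ K :=
    (eventually_ge_atTop ‖toR g‖).mono fun K hK y =>
      ((le_abs_self _).trans ((toR g).norm_coe_le_norm y)).trans hK
  refine Eventually.exists (f := atTop) ?_
  filter_upwards [eventually_ge_atTop 1, bound M.b, bound M.c, bound M.lam, bound M.a₁,
    bound M.a₂, bound M.a₃, bound M.a₄] with K h hb hc hl h₁ h₂ h₃ h₄
    using ⟨h, hb, hc, hl, h₁, h₂, h₃, h₄⟩

section Generator

variable {M : Coeffs} {N : ℕ} {K : ℝ}

/-- `Jump M x y`: the process can jump from `x` to `y`. -/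
inductive Jump (M : Coeffs) {N : ℕ} (x : State N) : State N → Prop
  | site (i : Fin N) : Jump M x (jumpSite M i x)
  | pair (i j : Fin N) (hji : j ≠ i) : Jump M x (jumpPair M i j x)

/-- The integral against the jump kernel: the sum of `g y` over the possible jumps `x ↦ y`, each
weighted by its rate. -/
def jumpSum (M : Coeffs) {N : ℕ} (x : State N) : (State N → ℝ) →ₗ[ℝ] ℝ :=
  ∑ i : Fin N, (M.b (pos i) : ℝ) • LinearMap.proj (jumpSite M i x) +
    (1 / N : ℝ) • ∑ i : Fin N, ∑ j ∈ Finset.univ.filter (fun j => j ≠ i),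
      (M.lam (pos i, pos j) : ℝ) • LinearMap.proj (jumpPair M i j x)

theorem jumpSum_apply (x : State N) (g : State N → ℝ) :
    jumpSum M x g = ∑ i : Fin N, (M.b (pos i) : ℝ) * g (jumpSite M i x) +
      (1 / N : ℝ) * ∑ i : Fin N, ∑ j ∈ Finset.univ.filter (fun j => j ≠ i),
        (M.lam (pos i, pos j) : ℝ) * g (jumpPair M i j x) := by
  simp [jumpSum]

theorem jumpSum_mono {x : State N} {f g : State N → ℝ} (h : ∀ y, Jump M x y → f y ≤ g y) :
    jumpSum M x f ≤ jumpSum M x g := by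
  rw [jumpSum_apply, jumpSum_apply]
  gcongr with i _ i _ j hj
  · exact h _ (.site i)
  · exact h _ (.pair i j (Finset.mem_filter.1 hj).2)

theorem abs_jumpSum_le (x : State N) (g : State N → ℝ) :
    |jumpSum M x g| ≤ jumpSum M x fun y => |g y| := by
  refine abs_le.2 ⟨?_, jumpSum_mono fun y _ => le_abs_self _⟩
  rw [← map_neg]
  exact jumpSum_mono fun y _ => neg_abs_le _

/-- If the jump at `i` contributes at most `A i` and the jump at `(i, j)` at most `A i + A j`, then
the factor `1 / N` makes up for the `N` jumps in which each urn is involved. -/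
theorem jumpSum_le (hK : M.BoundedBy K) {g : State N → ℝ} {x : State N} {A : Fin N → ℝ}
    (hA : ∀ i, 0 ≤ A i) (hs : ∀ i, g (jumpSite M i x) ≤ A i)
    (hp : ∀ i j, j ≠ i → g (jumpPair M i j x) ≤ A i + A j) :
    jumpSum M x g ≤ 3 * K * ∑ i, A i := by
  have hK0 : 0 ≤ K := zero_le_one.trans hK.one_le
  have hA₂ (i j : Fin N) : 0 ≤ A i + A j := add_nonneg (hA i) (hA j)
  have sites : ∑ i : Fin N, (M.b (pos i) : ℝ) * g (jumpSite M i x) ≤ K * ∑ i, A i := by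
    rw [Finset.mul_sum]
    refine Finset.sum_le_sum fun i _ => ?_
    exact (mul_le_mul_of_nonneg_left (hs i) (M.b _).2).trans
      (mul_le_mul_of_nonneg_right (hK.b_le _) (hA i))
  have pairs : ∑ i : Fin N, ∑ j ∈ Finset.univ.filter (fun j => j ≠ i),
      (M.lam (pos i, pos j) : ℝ) * g (jumpPair M i j x) ≤ N * (2 * K * ∑ i, A i) :=
    calc _ ≤ ∑ i : Fin N, ∑ j ∈ Finset.univ.filter (fun j => j ≠ i), K * (A i + A j) := by
          refine Finset.sum_le_sum fun i _ => Finset.sum_le_sum fun j hj => ?_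
          exact (mul_le_mul_of_nonneg_left (hp i j (Finset.mem_filter.1 hj).2) (M.lam _).2).trans
            (mul_le_mul_of_nonneg_right (hK.lam_le _) (hA₂ i j))
      _ ≤ ∑ i : Fin N, ∑ j : Fin N, K * (A i + A j) := by
          gcongr with i
          · exact fun j _ _ => mul_nonneg hK0 (hA₂ i j)
          · exact Finset.filter_subset _ _
      _ = N * (2 * K * ∑ i, A i) := by
          simp only [← Finset.mul_sum, Finset.sum_add_distrib, Finset.sum_const, Finset.card_univ,
            Fintype.card_fin, nsmul_eq_mul]
          ring
  rcases N.eq_zero_or_pos with rfl | hN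
  · simp [jumpSum_apply]
  calc jumpSum M x g ≤ K * ∑ i, A i + (1 / N : ℝ) * (N * (2 * K * ∑ i, A i)) := by
        rw [jumpSum_apply]; gcongr
    _ = 3 * K * ∑ i, A i := by field_simp; ring

/-- The generator on arbitrary, possibly unbounded, functions. -/
def gen (M : Coeffs) {N : ℕ} : (State N → ℝ) →ₗ[ℝ] State N → ℝ :=
  LinearMap.pi fun x => jumpSum M x - jumpSum M x 1 • LinearMap.proj x

theorem gen_apply (f : State N → ℝ) (x : State N) :
    gen M f x = jumpSum M x fun y => f y - f x := by
  have : (fun y => f y - f x) = f - f x • (1 : State N → ℝ) := by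
    ext y
    simp
  rw [this, map_sub, map_smul]
  simp [gen, mul_comm]

theorem coe_generator (f : State N →ᵇ ℝ) : ⇑(generator M N f) = gen M f := by
  ext x
  rw [generator_apply, gen_apply, jumpSum_apply]

/-- The carré du champ `Γ(f) = L(f²) - 2 f L f`; see `gen_sq`. -/
def gam (M : Coeffs) {N : ℕ} (f : State N → ℝ) (x : State N) : ℝ :=
  jumpSum M x fun y => (f y - f x) ^ 2

theorem gen_sq (f : State N → ℝ) (x : State N) :
    gen M (f ^ 2) x = 2 * f x * gen M f x + gam M f x := by
  rw [gen_apply, gen_apply, gam, ← smul_eq_mul (2 * f x), ← map_smul, ← map_add]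
  congr 1
  ext y
  simp only [Pi.add_apply, Pi.smul_apply, Pi.pow_apply, smul_eq_mul]
  ring

theorem sum_jumpSite_sub (M : Coeffs) (F : Fin N → ℝ≥0 → ℝ) (i : Fin N) (x : State N) :
    ∑ k, F k (jumpSite M i x k) - ∑ k, F k (x k) = F i (M.c (pos i) * x i) - F i (x i) := by
  rw [← Finset.sum_sub_distrib, Finset.sum_eq_single i]
  · simp [jumpSite]
  · intro k _ hk
    simp [jumpSite, hk]
  · simp

theorem sum_jumpPair_sub (M : Coeffs) (F : Fin N → ℝ≥0 → ℝ) {i j : Fin N} (hji : j ≠ i)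
    (x : State N) :
    ∑ k, F k (jumpPair M i j x k) - ∑ k, F k (x k) =
      (F i (M.a₁ (pos i, pos j) * x i + M.a₂ (pos i, pos j) * x j) - F i (x i)) +
      (F j (M.a₃ (pos i, pos j) * x i + M.a₄ (pos i, pos j) * x j) - F j (x j)) := by
  rw [← Finset.sum_sub_distrib, Fintype.sum_eq_add i j hji.symm]
  · simp [jumpPair, hji]
  · intro k hk
    simp [jumpPair, hk.1, hk.2]

end Generator

section PolynomialGrowth

variable {M : Coeffs} {N : ℕ} {K : ℝ}

/-- The scale `1 + ∑ₖ x(k)` against which the growth of functions on the state space is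
measured. -/
def weight {N : ℕ} (x : State N) : ℝ := 1 + ∑ k, (x k : ℝ)

theorem one_le_weight (x : State N) : 1 ≤ weight x :=
  le_add_of_nonneg_right (Finset.sum_nonneg fun _ _ => NNReal.coe_nonneg _)

theorem weight_nonneg (x : State N) : 0 ≤ weight x := zero_le_one.trans (one_le_weight x)

theorem continuous_weight : Continuous (weight : State N → ℝ) := by
  unfold weight
  fun_prop

theorem coe_le_weight (x : State N) (k : Fin N) : (x k : ℝ) ≤ weight x :=
  (Finset.single_le_sum (f := fun k => (x k : ℝ)) (fun _ _ => NNReal.coe_nonneg _)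
    (Finset.mem_univ k)).trans (le_add_of_nonneg_left zero_le_one)

theorem Jump.weight_le (hK : M.BoundedBy K) {x y : State N} (h : Jump M x y) :
    weight y ≤ (1 + 4 * K) * weight x := by
  have hK0 : 0 ≤ K := zero_le_one.trans hK.one_le
  have hx (a : ℝ≥0) (ha : (a : ℝ) ≤ K) (k : Fin N) : (a * x k : ℝ) ≤ K * weight x := by
    gcongr
    exact coe_le_weight x k
  have hx₀ (k : Fin N) : 0 ≤ (x k : ℝ) := (x k).2
  have hw : weight x = 1 + ∑ k, (x k : ℝ) := rfl
  have hw' : weight y = 1 + ∑ k, (y k : ℝ) := rfl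
  have hw₀ := mul_nonneg hK0 (weight_nonneg x)
  cases h with
  | site i =>
    have hi := sum_jumpSite_sub M (fun _ z => (z : ℝ)) i x
    push_cast at hi
    linarith [hx _ (hK.c_le (pos i)) i, hx₀ i]
  | pair i j hji =>
    have hij := sum_jumpPair_sub M (fun _ z => (z : ℝ)) hji x
    push_cast at hij
    linarith [hx _ (hK.a₁_le (pos i, pos j)) i, hx _ (hK.a₂_le (pos i, pos j)) j,
      hx _ (hK.a₃_le (pos i, pos j)) i, hx _ (hK.a₄_le (pos i, pos j)) j, hx₀ i, hx₀ j]

theorem isBigO_weight_pow_of_le {q r : ℕ} (hqr : q ≤ r) :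
    (fun x : State N => weight x ^ q) =O[⊤] fun x => weight x ^ r :=
  Asymptotics.isBigO_top.2 ⟨1, fun x => by
    rw [one_mul, Real.norm_of_nonneg (pow_nonneg (weight_nonneg x) q),
      Real.norm_of_nonneg (pow_nonneg (weight_nonneg x) r)]
    exact pow_le_pow_right₀ (one_le_weight x) hqr⟩

/-- The continuous functions of at most polynomial growth on the state space. -/
def polyGrowth (N : ℕ) : Subalgebra ℝ (State N → ℝ) where
  carrier := {f | Continuous f ∧ ∃ q : ℕ, f =O[⊤] fun x => weight x ^ q}
  mul_mem' := fun ⟨hf, q, hfq⟩ ⟨hg, r, hgr⟩ =>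
    ⟨hf.mul hg, q + r, by simp only [pow_add]; exact hfq.mul hgr⟩
  add_mem' := fun ⟨hf, q, hfq⟩ ⟨hg, r, hgr⟩ =>
    ⟨hf.add hg, max q r, (hfq.trans (isBigO_weight_pow_of_le (le_max_left q r))).add
      (hgr.trans (isBigO_weight_pow_of_le (le_max_right q r)))⟩
  algebraMap_mem' r := ⟨continuous_const, 0, by
    simp only [pow_zero]
    exact Asymptotics.isBigO_const_const r one_ne_zero ⊤⟩

theorem coord_mem_polyGrowth (k : Fin N) : (fun x : State N => (x k : ℝ)) ∈ polyGrowth N :=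
  ⟨by fun_prop, 1, Asymptotics.isBigO_top.2 ⟨1, fun x => by
    rw [one_mul, pow_one, Real.norm_of_nonneg (NNReal.coe_nonneg _),
      Real.norm_of_nonneg (weight_nonneg x)]
    exact coe_le_weight x k⟩⟩

theorem const_mem_polyGrowth (r : ℝ) : (fun _ : State N => r) ∈ polyGrowth N :=
  (polyGrowth N).algebraMap_mem r

theorem comp_mem_polyGrowth {f : State N → ℝ} (hf : f ∈ polyGrowth N) {J : State N → State N}
    (hJ : Continuous J) {κ : ℝ} (hκ : ∀ x, weight (J x) ≤ κ * weight x) :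
    f ∘ J ∈ polyGrowth N := by
  obtain ⟨hc, q, hq⟩ := hf
  have hw : (weight ∘ J) =O[⊤] (weight : State N → ℝ) :=
    Asymptotics.isBigO_top.2 ⟨κ, fun x => by
      rw [Function.comp_apply, Real.norm_of_nonneg (weight_nonneg _),
        Real.norm_of_nonneg (weight_nonneg _)]
      exact hκ x⟩
  exact ⟨hc.comp hJ, q, (hq.comp_tendsto tendsto_top).trans (hw.pow q)⟩

theorem jumpSum_mem_polyGrowth (M : Coeffs) {f : State N → ℝ} (hf : f ∈ polyGrowth N) :
    (fun x => jumpSum M x f) ∈ polyGrowth N := by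
  obtain ⟨K, hK⟩ := M.exists_boundedBy
  have hs (i : Fin N) : f ∘ jumpSite M i ∈ polyGrowth N :=
    comp_mem_polyGrowth hf (continuous_jumpSite M i) fun x => (Jump.site i).weight_le hK
  have hp (i j : Fin N) (hji : j ≠ i) : f ∘ jumpPair M i j ∈ polyGrowth N :=
    comp_mem_polyGrowth hf (continuous_jumpPair M i j) fun x => (Jump.pair i j hji).weight_le hK
  have : (fun x => jumpSum M x f) = ∑ i : Fin N, (M.b (pos i) : ℝ) • (f ∘ jumpSite M i) +
      (1 / N : ℝ) • ∑ i : Fin N, ∑ j ∈ Finset.univ.filter (fun j => j ≠ i),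
        (M.lam (pos i, pos j) : ℝ) • (f ∘ jumpPair M i j) := by
    ext x
    simp [jumpSum_apply]
  rw [this]
  refine add_mem (sum_mem fun i _ => Subalgebra.smul_mem _ (hs i) _)
    (Subalgebra.smul_mem _ (sum_mem fun i _ => sum_mem fun j hj => ?_) _)
  exact Subalgebra.smul_mem _ (hp i j (Finset.mem_filter.1 hj).2) _

theorem gen_mem_polyGrowth (M : Coeffs) {f : State N → ℝ} (hf : f ∈ polyGrowth N) :
    gen M f ∈ polyGrowth N :=
  sub_mem (jumpSum_mem_polyGrowth M hf)
    (mul_mem (jumpSum_mem_polyGrowth M (one_mem _)) hf)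

end PolynomialGrowth

theorem le_gronwallBound_of_hasDerivWithinAt {f f' : ℝ → ℝ} {K ε T : ℝ}
    (hf : ∀ t ∈ Set.Icc 0 T, HasDerivWithinAt f (f' t) (Set.Icc 0 T) t)
    (hle : ∀ t ∈ Set.Icc 0 T, f' t ≤ K * f t + ε) {t : ℝ} (ht : t ∈ Set.Icc 0 T) :
    f t ≤ gronwallBound (f 0) K ε t := by
  have key := le_gronwallBound_of_liminf_deriv_right_le (f' := f')
    (fun s hs => (hf s hs).continuousWithinAt) (fun s hs r hr => ?_) le_rfl
    (fun s hs => hle s (Set.Ico_subset_Icc_self hs)) t ht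
  · rwa [sub_zero] at key
  · simpa only [slope_def_field, div_eq_inv_mul] using
      ((hf s (Set.Ico_subset_Icc_self hs)).mono_of_mem_nhdsWithin
        (Icc_mem_nhdsGE_of_mem hs)).liminf_right_slope_le hr

theorem integrable_and_integral_le_of_tendsto {Ω : Type*} [MeasurableSpace Ω] {P : Measure Ω}
    {F : ℕ → Ω → ℝ} {f : Ω → ℝ} {B : ℝ} (hF : ∀ m, Integrable (F m) P) (hF0 : ∀ m ω, 0 ≤ F m ω)
    (hB : ∀ m, ∫ ω, F m ω ∂P ≤ B) (h : ∀ ω, Tendsto (fun m => F m ω) atTop (𝓝 (f ω))) :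
    Integrable f P ∧ ∫ ω, f ω ∂P ≤ B := by
  have hf0 : 0 ≤ᵐ[P] f := .of_forall fun ω => ge_of_tendsto' (h ω) fun m => hF0 m ω
  have hf : AEStronglyMeasurable f P :=
    aestronglyMeasurable_of_tendsto_ae atTop (fun m => (hF m).aestronglyMeasurable) (.of_forall h)
  have fatou : ∫⁻ ω, ENNReal.ofReal (f ω) ∂P ≤ ENNReal.ofReal B := by
    calc ∫⁻ ω, ENNReal.ofReal (f ω) ∂P
        = ∫⁻ ω, liminf (fun m => ENNReal.ofReal (F m ω)) atTop ∂P :=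
          lintegral_congr fun ω =>
            ((ENNReal.continuous_ofReal.tendsto _).comp (h ω)).liminf_eq.symm
      _ ≤ liminf (fun m => ∫⁻ ω, ENNReal.ofReal (F m ω) ∂P) atTop :=
          lintegral_liminf_le' fun m => (hF m).aestronglyMeasurable.aemeasurable.ennreal_ofReal
      _ ≤ ENNReal.ofReal B := by
          refine liminf_le_of_frequently_le' (.of_forall fun m => ?_)
          rw [← ofReal_integral_eq_lintegral_ofReal (hF m) (.of_forall (hF0 m))]
          exact ENNReal.ofReal_le_ofReal (hB m)
  have hint : Integrable f P :=
    ⟨hf, (hasFiniteIntegral_iff_ofReal hf0).2 (fatou.trans_lt ENNReal.ofReal_lt_top)⟩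
  have hB0 : 0 ≤ B := (integral_nonneg (hF0 0)).trans (hB 0)
  exact ⟨hint, (ENNReal.ofReal_le_ofReal_iff hB0).1
    ((ofReal_integral_eq_lintegral_ofReal hint hf0).trans_le fatou)⟩

theorem hasDerivAt_opExp_smul_apply {E : Type*} [NormedAddCommGroup E] [NormedSpace ℝ E]
    [CompleteSpace E] (A : E →L[ℝ] E) (f : E) (t : ℝ) :
    HasDerivAt (fun s : ℝ => opExp (s • A) f) (opExp (t • A) (A f)) t := by
  simpa [opExp] using (hasDerivAt_exp_smul_const (𝕂 := ℝ) A t).clm_apply (hasDerivAt_const t f)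

/-- The truncation of a continuous function at the levels `± (m + 1)`, as a bounded continuous
function. -/
def clip {Y : Type*} [TopologicalSpace Y] (m : ℕ) {f : Y → ℝ} (hf : Continuous f) : Y →ᵇ ℝ :=
  .ofNormedAddCommGroup (fun y => max (-(m + 1 : ℝ)) (min (f y) (m + 1))) (by fun_prop) (m + 1)
    fun y => abs_le.2 ⟨le_max_left _ _, max_le (by linarith [m.cast_nonneg (α := ℝ)])
      (min_le_right _ _)⟩

section Clip

variable {Y : Type*} [TopologicalSpace Y] {f : Y → ℝ} (hf : Continuous f)

theorem clip_apply (m : ℕ) (y : Y) :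
    clip m hf y = max (-(m + 1 : ℝ)) (min (f y) (m + 1)) := rfl

theorem abs_sub_clip_le (m : ℕ) (y : Y) : |f y - clip m hf y| ≤ f y ^ 2 / (m + 1) := by
  have hm : (0 : ℝ) < m + 1 := m.cast_add_one_pos
  rw [clip_apply, le_div_iff₀ hm]
  rcases le_total (f y) (m + 1) with h | h
  · rcases le_total (-(m + 1 : ℝ)) (f y) with h' | h'
    · rw [min_eq_left h, max_eq_right h']
      simp [sq_nonneg]
    · rw [min_eq_left h, max_eq_left h', abs_of_nonpos (by linarith)]
      nlinarith
  · rw [min_eq_right h, max_eq_right (by linarith), abs_of_nonneg (by linarith)]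
    nlinarith

theorem tendsto_clip (y : Y) : Tendsto (fun m => clip m hf y) atTop (𝓝 (f y)) := by
  rw [tendsto_iff_norm_sub_tendsto_zero]
  refine squeeze_zero (fun m => norm_nonneg _) (fun m => ?_) (tendsto_const_nhds.div_atTop
    (tendsto_natCast_atTop_atTop.atTop_add tendsto_const_nhds) : Tendsto
      (fun m : ℕ => f y ^ 2 / (m + 1 : ℝ)) atTop (𝓝 0))
  rw [norm_sub_rev]
  exact abs_sub_clip_le hf m y

theorem clip_nonneg (hf0 : ∀ y, 0 ≤ f y) (m : ℕ) (y : Y) : 0 ≤ clip m hf y :=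
  le_max_of_le_right (le_min (hf0 y) m.cast_add_one_pos.le)

theorem clip_le (hf0 : ∀ y, 0 ≤ f y) (m : ℕ) (y : Y) : clip m hf y ≤ f y :=
  max_le (by linarith [hf0 y, m.cast_add_one_pos (α := ℝ)]) (min_le_left _ _)

theorem clip_le_mul_clip (hf0 : ∀ y, 0 ≤ f y) {κ : ℝ} (hκ : 1 ≤ κ) (m : ℕ) {y z : Y}
    (h : f z ≤ κ * f y) : clip m hf z ≤ κ * clip m hf y := by
  have hm : (0 : ℝ) < m + 1 := m.cast_add_one_pos
  have eq_min (y : Y) : clip m hf y = min (f y) (m + 1) :=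
    max_eq_right (by linarith [le_min (hf0 y) hm.le])
  rw [eq_min, eq_min, mul_min_of_nonneg _ _ (zero_le_one.trans hκ)]
  exact min_le_min h (le_mul_of_one_le_left hm.le hκ)

end Clip

/-- The expectation of `f (X t)`; times `t < 0` are read as `0`. -/
def expect {Ω E : Type*} [MeasurableSpace Ω] (P : Measure Ω) (X : ℝ≥0 → Ω → E) (t : ℝ)
    (f : E → ℝ) : ℝ :=
  ∫ ω, f (X t.toNNReal ω) ∂P

section ForwardEquation

variable {M : Coeffs} {N : ℕ} {Ω : Type*} [MeasurableSpace Ω] {P : Measure Ω}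
  [IsProbabilityMeasure P] {X : ℝ≥0 → Ω → State N}

/-- Integration against a finite measure, as a functional on the bounded continuous functions. -/
def boundedIntegral {E : Type*} [TopologicalSpace E] [MeasurableSpace E] [OpensMeasurableSpace E]
    (μ : Measure E) [IsFiniteMeasure μ] : (E →ᵇ ℝ) →L[ℝ] ℝ :=
  LinearMap.mkContinuous
    { toFun := fun f => ∫ x, f x ∂μ
      map_add' := fun f g => integral_add (f.integrable μ) (g.integrable μ)
      map_smul' := fun r f => integral_const_mul r f } (μ.real Set.univ)
    fun f => f.norm_integral_le_mul_norm μ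

theorem IsLinearSystem.integrable_bounded (hX : IsLinearSystem M N P X) (t : ℝ≥0)
    (f : State N →ᵇ ℝ) : Integrable (fun ω => f (X t ω)) P :=
  have := Measure.isProbabilityMeasure_map (μ := P) (hX.measurable t).aemeasurable
  (f.integrable (P.map (X t))).comp_measurable (hX.measurable t)

theorem IsLinearSystem.exists_expect_eq (hX : IsLinearSystem M N P X) :
    ∃ ν : (State N →ᵇ ℝ) →L[ℝ] ℝ, ∀ (f : State N →ᵇ ℝ) (t : ℝ), 0 ≤ t →
      expect P X t f = ν (opExp (t • generator M N) f) := by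
  have := Measure.isProbabilityMeasure_map (μ := P) (hX.measurable 0).aemeasurable
  refine ⟨boundedIntegral (P.map (X 0)), fun f t ht => ?_⟩
  have hm : past X 0 ≤ (inferInstance : MeasurableSpace Ω) :=
    iSup_le fun r => (hX.measurable r).comap_le
  have markov := hX.markov 0 t.toNNReal f
  rw [zero_add] at markov
  calc expect P X t f = ∫ ω, semigroup M N t.toNNReal f (X 0 ω) ∂P := by
        rw [expect, ← integral_condExp hm, integral_congr_ae markov]
    _ = ∫ x, semigroup M N t.toNNReal f x ∂P.map (X 0) :=
        (integral_map (hX.measurable 0).aemeasurable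
          (BoundedContinuousFunction.continuous _).aestronglyMeasurable).symm
    _ = boundedIntegral (P.map (X 0)) (opExp (t • generator M N) f) := by
        rw [semigroup, Real.coe_toNNReal t ht]
        rfl

theorem IsLinearSystem.hasDerivWithinAt_expect_bounded (hX : IsLinearSystem M N P X)
    (f : State N →ᵇ ℝ) {t : ℝ} (ht : 0 ≤ t) :
    HasDerivWithinAt (fun s => expect P X s f) (expect P X t (gen M f)) (Set.Ici 0) t := by
  obtain ⟨ν, hν⟩ := hX.exists_expect_eq
  rw [← coe_generator, hν _ t ht]
  exact ((ν.hasFDerivAt.comp_hasDerivAt t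
    (hasDerivAt_opExp_smul_apply (generator M N) f t)).hasDerivWithinAt (s := Set.Ici 0)).congr
    (fun s hs => hν f s hs) (hν f t ht)

theorem IsLinearSystem.expect_mono_bounded (hX : IsLinearSystem M N P X) (t : ℝ)
    {f g : State N →ᵇ ℝ} (h : ∀ x, f x ≤ g x) : expect P X t f ≤ expect P X t g :=
  integral_mono (hX.integrable_bounded _ f) (hX.integrable_bounded _ g) fun _ => h _

theorem jumpSum_one_le {K : ℝ} (hK : M.BoundedBy K) (x : State N) :
    jumpSum M x 1 ≤ 3 * K * N := by
  simpa using jumpSum_le hK (g := 1) (x := x) (A := 1) (fun _ => zero_le_one) (fun _ => le_rfl)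
    fun _ _ _ => by norm_num

theorem gen_le_of_jump_le {K : ℝ} (hK : M.BoundedBy K) {V : State N → ℝ} (hV0 : ∀ x, 0 ≤ V x)
    {κ : ℝ} (hκ : 1 ≤ κ) {x : State N} (hV : ∀ y, Jump M x y → V y ≤ κ * V x) :
    gen M V x ≤ 3 * K * N * (κ - 1) * V x := by
  have hκV : 0 ≤ (κ - 1) * V x := mul_nonneg (by linarith) (hV0 x)
  calc gen M V x ≤ jumpSum M x (((κ - 1) * V x) • 1) := by
        rw [gen_apply]
        refine jumpSum_mono fun y hy => ?_
        simp only [Pi.smul_apply, Pi.one_apply, smul_eq_mul]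
        linarith [hV y hy]
    _ = (κ - 1) * V x * jumpSum M x 1 := by rw [map_smul, smul_eq_mul]
    _ ≤ (κ - 1) * V x * (3 * K * N) := mul_le_mul_of_nonneg_left (jumpSum_one_le hK x) hκV
    _ = 3 * K * N * (κ - 1) * V x := by ring

theorem IsLinearSystem.exists_expect_le_of_jump_le (hX : IsLinearSystem M N P X)
    {V : State N → ℝ} (hVc : Continuous V) (hV0 : ∀ x, 0 ≤ V x) {κ : ℝ} (hκ : 1 ≤ κ)
    (hV : ∀ x y, Jump M x y → V y ≤ κ * V x) {B₀ : ℝ} (h0 : ∀ᵐ ω ∂P, V (X 0 ω) ≤ B₀) (T : ℝ) :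
    ∃ B, ∀ t ∈ Set.Icc 0 T,
      Integrable (fun ω => V (X t.toNNReal ω)) P ∧ expect P X t V ≤ B := by
  obtain ⟨K, hK⟩ := M.exists_boundedBy
  have hB₀ : 0 ≤ B₀ := h0.exists.elim fun ω hω => (hV0 _).trans hω
  set C := 3 * K * N * (κ - 1)
  have hC : 0 ≤ C := mul_nonneg
    (mul_nonneg (mul_nonneg zero_le_three (zero_le_one.trans hK.one_le)) N.cast_nonneg)
    (by linarith)
  refine ⟨B₀ * Real.exp (C * T), fun t ht => ?_⟩
  refine integrable_and_integral_le_of_tendsto (fun m => hX.integrable_bounded _ (clip m hVc))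
    (fun m ω => clip_nonneg hVc hV0 m _) (fun m => ?_) fun ω => tendsto_clip hVc _
  have init : expect P X 0 (clip m hVc) ≤ B₀ := by
    rw [expect, Real.toNNReal_zero]
    calc _ ≤ ∫ _ : Ω, B₀ ∂P := integral_mono_ae (hX.integrable_bounded 0 _) (integrable_const _)
          (h0.mono fun ω hω => (clip_le hVc hV0 m _).trans hω)
      _ = B₀ := by simp
  have growth (s : ℝ) :
      expect P X s (gen M (clip m hVc)) ≤ C * expect P X s (clip m hVc) + 0 := by
    have hgen (x : State N) : gen M (clip m hVc) x ≤ C * clip m hVc x :=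
      gen_le_of_jump_le hK (clip_nonneg hVc hV0 m) hκ
        fun y hy => clip_le_mul_clip hVc hV0 hκ m (hV x y hy)
    rw [← coe_generator, add_zero]
    exact (hX.expect_mono_bounded s (g := C • clip m hVc) fun x => by
      rw [coe_generator]; exact hgen x).trans_eq (integral_const_mul C _)
  calc expect P X t (clip m hVc)
      ≤ gronwallBound (expect P X 0 (clip m hVc)) C 0 t :=
        le_gronwallBound_of_hasDerivWithinAt (T := T)
          (fun s hs => (hX.hasDerivWithinAt_expect_bounded _ hs.1).mono Set.Icc_subset_Ici_self)
          (fun s _ => growth s) ht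
    _ ≤ B₀ * Real.exp (C * T) := by
        rw [gronwallBound_ε0]
        gcongr
        exact ht.2

end ForwardEquation

section Dynkin

variable {M : Coeffs} {N : ℕ} {Ω : Type*} [MeasurableSpace Ω] {P : Measure Ω}
  [IsProbabilityMeasure P] {X : ℝ≥0 → Ω → State N} (hX : IsLinearSystem M N P X)
  (h0 : ∀ᵐ ω ∂P, ∀ i, X 0 ω i ≤ 1) {f g : State N → ℝ}

include hX h0

theorem exists_expect_weight_pow_le (q : ℕ) (T : ℝ) :
    ∃ B, ∀ t ∈ Set.Icc 0 T, Integrable (fun ω => weight (X t.toNNReal ω) ^ q) P ∧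
      expect P X t (fun x => weight x ^ q) ≤ B := by
  obtain ⟨K, hK⟩ := M.exists_boundedBy
  have hκ : 1 ≤ (1 + 4 * K) ^ q := one_le_pow₀ (by linarith [hK.one_le])
  refine hX.exists_expect_le_of_jump_le (continuous_weight.pow q)
    (fun x => pow_nonneg (weight_nonneg x) q) hκ (fun x y hxy => ?_) (B₀ := (1 + N) ^ q) ?_ T
  · refine le_of_le_of_eq ?_ (mul_pow _ _ q)
    exact pow_le_pow_left₀ (weight_nonneg y) (hxy.weight_le hK) q
  · filter_upwards [h0] with ω hω
    refine pow_le_pow_left₀ (weight_nonneg _) (add_le_add_right ?_ 1) q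
    exact (Finset.sum_le_sum fun i _ => NNReal.coe_le_one.2 (hω i)).trans_eq (by simp)

theorem exists_expect_abs_le (hf : f ∈ polyGrowth N) (T : ℝ) :
    ∃ B, ∀ t ∈ Set.Icc 0 T, Integrable (fun ω => f (X t.toNNReal ω)) P ∧
      expect P X t (fun x => |f x|) ≤ B := by
  obtain ⟨hfc, q, hfq⟩ := hf
  obtain ⟨C, hC⟩ := Asymptotics.isBigO_top.1 hfq
  obtain ⟨B, hB⟩ := exists_expect_weight_pow_le hX h0 q T
  have hfC (x : State N) : |f x| ≤ |C| * weight x ^ q := by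
    refine (hC x).trans (mul_le_mul (le_abs_self C) (Real.norm_of_nonneg ?_).le (norm_nonneg _)
      (abs_nonneg C))
    exact pow_nonneg (weight_nonneg x) q
  refine ⟨|C| * B, fun t ht => ?_⟩
  obtain ⟨hint, hle⟩ := hB t ht
  have hfint : Integrable (fun ω => f (X t.toNNReal ω)) P :=
    (hint.const_mul |C|).mono' (hfc.measurable.comp (hX.measurable _)).aestronglyMeasurable
      (.of_forall fun ω => hfC _)
  refine ⟨hfint, (integral_mono hfint.abs (hint.const_mul |C|) fun ω => hfC _).trans ?_⟩
  rw [integral_const_mul]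
  exact mul_le_mul_of_nonneg_left hle (abs_nonneg C)

theorem integrable_of_mem_polyGrowth (hf : f ∈ polyGrowth N) (t : ℝ≥0) :
    Integrable (fun ω => f (X t ω)) P := by
  obtain ⟨B, hB⟩ := exists_expect_abs_le hX h0 hf t
  simpa using (hB t ⟨t.2, le_rfl⟩).1

theorem expect_mono (hf : f ∈ polyGrowth N) (hg : g ∈ polyGrowth N) (h : ∀ x, f x ≤ g x) (t : ℝ) :
    expect P X t f ≤ expect P X t g :=
  integral_mono (integrable_of_mem_polyGrowth hX h0 hf _)
    (integrable_of_mem_polyGrowth hX h0 hg _) fun _ => h _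

theorem expect_add (hf : f ∈ polyGrowth N) (hg : g ∈ polyGrowth N) (t : ℝ) :
    expect P X t (f + g) = expect P X t f + expect P X t g :=
  integral_add (integrable_of_mem_polyGrowth hX h0 hf _) (integrable_of_mem_polyGrowth hX h0 hg _)

omit [IsProbabilityMeasure P] hX h0 in
theorem expect_smul (r : ℝ) (f : State N → ℝ) (t : ℝ) :
    expect P X t (r • f) = r * expect P X t f :=
  integral_const_mul r _

theorem expect_sum {ι : Type*} (s : Finset ι) {φ : ι → State N → ℝ}
    (hφ : ∀ a ∈ s, φ a ∈ polyGrowth N) (t : ℝ) :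
    expect P X t (∑ a ∈ s, φ a) = ∑ a ∈ s, expect P X t (φ a) := by
  simp only [expect, Finset.sum_apply]
  exact integral_finsetSum s fun a ha => integrable_of_mem_polyGrowth hX h0 (hφ a ha) _

theorem tendstoUniformlyOn_expect {F : ℕ → State N → ℝ} (hF : ∀ m, F m ∈ polyGrowth N)
    (hf : f ∈ polyGrowth N) (hg : g ∈ polyGrowth N)
    (hle : ∀ m x, |f x - F m x| ≤ g x / (m + 1)) (T : ℝ) :
    TendstoUniformlyOn (fun m t => expect P X t (F m)) (fun t => expect P X t f) atTop
      (Set.Icc 0 T) := by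
  obtain ⟨B, hB⟩ := exists_expect_abs_le hX h0 hg T
  have hlim : Tendsto (fun m : ℕ => B / (m + 1 : ℝ)) atTop (𝓝 0) :=
    tendsto_const_nhds.div_atTop (tendsto_natCast_atTop_atTop.atTop_add tendsto_const_nhds)
  refine Metric.tendstoUniformlyOn_iff.2 fun ε hε => ?_
  filter_upwards [hlim.eventually_lt_const hε] with m hm t ht
  have hint {h : State N → ℝ} (hh : h ∈ polyGrowth N) :=
    integrable_of_mem_polyGrowth hX h0 hh t.toNNReal
  have hm0 : (0 : ℝ) ≤ m + 1 := m.cast_add_one_pos.le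
  calc dist (expect P X t f) (expect P X t (F m))
      = |∫ ω, (f (X t.toNNReal ω) - F m (X t.toNNReal ω)) ∂P| := by
        rw [Real.dist_eq, expect, expect, integral_sub (hint hf) (hint (hF m))]
    _ ≤ ∫ ω, |g (X t.toNNReal ω)| / (m + 1) ∂P :=
        abs_integral_le_integral_abs.trans <|
          integral_mono ((hint hf).sub (hint (hF m))).abs ((hint hg).abs.div_const _) fun ω =>
            (hle m _).trans (div_le_div_of_nonneg_right (le_abs_self _) hm0)
    _ ≤ B / (m + 1) := by
        rw [integral_div]
        exact div_le_div_of_nonneg_right (hB t ht).2 hm0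
    _ < ε := hm

omit [IsProbabilityMeasure P] hX h0 in
theorem coe_mem_polyGrowth (f : State N →ᵇ ℝ) : ⇑f ∈ polyGrowth N :=
  ⟨f.continuous, 0, Asymptotics.isBigO_top.2 ⟨‖f‖, fun x => by
    simpa using f.norm_coe_le_norm x⟩⟩

theorem tendstoUniformlyOn_expect_clip (hf : f ∈ polyGrowth N) (T : ℝ) :
    TendstoUniformlyOn (fun m t => expect P X t (clip m hf.1)) (fun t => expect P X t f) atTop
      (Set.Icc 0 T) :=
  tendstoUniformlyOn_expect hX h0 (fun _ => coe_mem_polyGrowth _) hf (pow_mem hf 2)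
    (abs_sub_clip_le hf.1) T

theorem tendstoUniformlyOn_expect_gen_clip (hf : f ∈ polyGrowth N) (T : ℝ) :
    TendstoUniformlyOn (fun m t => expect P X t (gen M (clip m hf.1)))
      (fun t => expect P X t (gen M f)) atTop (Set.Icc 0 T) := by
  refine tendstoUniformlyOn_expect hX h0 (fun _ => gen_mem_polyGrowth M (coe_mem_polyGrowth _))
    (gen_mem_polyGrowth M hf) (g := fun x => jumpSum M x (f ^ 2) + f x ^ 2 * jumpSum M x 1)
    (add_mem (jumpSum_mem_polyGrowth M (pow_mem hf 2))
      (mul_mem (pow_mem hf 2) (jumpSum_mem_polyGrowth M (one_mem _)))) (fun m x => ?_) T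
  have hclip := abs_sub_clip_le hf.1 m
  calc |gen M f x - gen M (clip m hf.1) x| = |gen M (f - ⇑(clip m hf.1)) x| := by
        rw [map_sub, Pi.sub_apply]
    _ ≤ jumpSum M x fun y => |(f - ⇑(clip m hf.1)) y - (f - ⇑(clip m hf.1)) x| := by
        rw [gen_apply]
        exact abs_jumpSum_le x _
    _ ≤ jumpSum M x ((m + 1 : ℝ)⁻¹ • (f ^ 2 + f x ^ 2 • 1)) := by
        refine jumpSum_mono fun y _ => (abs_sub _ _).trans ?_
        refine (add_le_add (hclip y) (hclip x)).trans_eq ?_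
        simp only [Pi.smul_apply, Pi.add_apply, Pi.pow_apply, Pi.one_apply, smul_eq_mul]
        ring
    _ = (jumpSum M x (f ^ 2) + f x ^ 2 * jumpSum M x 1) / (m + 1) := by
        simp only [map_smul, map_add, smul_eq_mul]
        ring

theorem continuousOn_expect (hf : f ∈ polyGrowth N) :
    ContinuousOn (fun t => expect P X t f) (Set.Ici 0) := fun t ht => by
  have hclip (m : ℕ) : ContinuousOn (fun t => expect P X t (clip m hf.1)) (Set.Icc 0 (t + 1)) :=
    fun s hs => (hX.hasDerivWithinAt_expect_bounded _ hs.1).continuousWithinAt.mono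
      Set.Icc_subset_Ici_self
  refine ((tendstoUniformlyOn_expect_clip hX h0 hf (t + 1)).continuousOn (.of_forall hclip) t
    ⟨ht, by linarith⟩).mono_of_mem_nhdsWithin ?_
  filter_upwards [self_mem_nhdsWithin, mem_nhdsWithin_of_mem_nhds (Iio_mem_nhds (lt_add_one t))]
    with s hs hst using ⟨hs, hst.le⟩

theorem hasDerivAt_expect (hf : f ∈ polyGrowth N) {t : ℝ} (ht : 0 < t) :
    HasDerivAt (fun s => expect P X s f) (expect P X t (gen M f)) t := by
  have hmem : t ∈ Set.Ioo 0 (t + 1) := ⟨ht, lt_add_one t⟩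
  refine hasDerivAt_of_tendstoUniformlyOn (f := fun m s => expect P X s (clip m hf.1)) isOpen_Ioo
    ((tendstoUniformlyOn_expect_gen_clip hX h0 hf (t + 1)).mono Set.Ioo_subset_Icc_self)
    (.of_forall fun m s hs => ?_) (fun s hs => ?_) hmem
  · exact (hX.hasDerivWithinAt_expect_bounded _ hs.1.le).hasDerivAt (Ici_mem_nhds hs.1)
  · exact (tendstoUniformlyOn_expect_clip hX h0 hf (t + 1)).tendsto_at
      (Set.Ioo_subset_Icc_self hs)

/-- Dynkin's formula, in differential form. -/
theorem hasDerivWithinAt_expect (hf : f ∈ polyGrowth N) {t : ℝ} (ht : 0 ≤ t) :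
    HasDerivWithinAt (fun s => expect P X s f) (expect P X t (gen M f)) (Set.Ici 0) t := by
  rcases ht.eq_or_lt with rfl | ht
  · refine hasDerivWithinAt_Ici_of_tendsto_deriv (s := Set.Ioi 0)
      (fun s hs => (hasDerivAt_expect hX h0 hf hs).differentiableAt.differentiableWithinAt)
      ((continuousOn_expect hX h0 hf 0 Set.self_mem_Ici).mono Set.Ioi_subset_Ici_self)
      self_mem_nhdsWithin ?_
    refine (((continuousOn_expect hX h0 (gen_mem_polyGrowth M hf)) 0 Set.self_mem_Ici).mono
      Set.Ioi_subset_Ici_self).tendsto.congr' ?_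
    filter_upwards [self_mem_nhdsWithin] with s hs using (hasDerivAt_expect hX h0 hf hs).deriv.symm
  · exact (hasDerivAt_expect hX h0 hf ht).hasDerivWithinAt

end Dynkin

section PowerAverages

variable {M : Coeffs} {N : ℕ} {K : ℝ} (p : ℕ) (f : C(I, ℝ))

/-- The integral of `f` against the empirical measure `(1/N) ∑ₖ x(k)ᵖ δ_{k/N}`. -/
def powEmp {N : ℕ} (p : ℕ) (f : C(I, ℝ)) (x : State N) : ℝ :=
  (1 / N : ℝ) * ∑ k, (x k : ℝ) ^ p * f (pos k)

theorem powEmp_eq_sum (x : State N) :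
    powEmp p f x = ∑ k, (1 / N : ℝ) * f (pos k) * (x k : ℝ) ^ p := by
  rw [powEmp, Finset.mul_sum]
  exact Finset.sum_congr rfl fun k _ => by ring

theorem powEmp_one_eq (x : State N) : powEmp p 1 x = (1 / N : ℝ) * ∑ k, (x k : ℝ) ^ p := by
  simp [powEmp]

theorem powEmp_one_nonneg (x : State N) : 0 ≤ powEmp p 1 x := by
  rw [powEmp_one_eq]
  positivity

theorem average_pow_mul_mem_polyGrowth (a : Fin N → ℝ) :
    (fun x : State N => (1 / N : ℝ) * ∑ k, (x k : ℝ) ^ p * a k) ∈ polyGrowth N := by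
  have : (fun x : State N => (1 / N : ℝ) * ∑ k, (x k : ℝ) ^ p * a k) =
      (1 / N : ℝ) • ∑ k : Fin N, a k • (fun x : State N => (x k : ℝ)) ^ p :=
    funext fun x => by simp [mul_comm (a _)]
  rw [this]
  exact Subalgebra.smul_mem _ (sum_mem fun k _ =>
    Subalgebra.smul_mem _ (pow_mem (coord_mem_polyGrowth k) p) _) _

theorem powEmp_mem_polyGrowth : powEmp p f ∈ polyGrowth N :=
  average_pow_mul_mem_polyGrowth p fun k => f (pos k)

theorem abs_average_pow_mul_le {a : Fin N → ℝ} {R : ℝ} (ha : ∀ k, |a k| ≤ R) (x : State N) :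
    |(1 / N : ℝ) * ∑ k, (x k : ℝ) ^ p * a k| ≤ R * powEmp p 1 x := by
  rw [powEmp_one_eq, abs_mul, abs_of_nonneg (by positivity : (0 : ℝ) ≤ 1 / N), mul_left_comm,
    Finset.mul_sum]
  gcongr
  refine (Finset.abs_sum_le_sum_abs _ _).trans (Finset.sum_le_sum fun k _ => ?_)
  rw [abs_mul, abs_of_nonneg (by positivity), mul_comm]
  exact mul_le_mul_of_nonneg_right (ha k) (by positivity)

theorem powEmp_one_sq_le (x : State N) : powEmp p 1 x ^ 2 ≤ powEmp (p * 2) 1 x := by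
  rcases N.eq_zero_or_pos with rfl | _
  · simp [powEmp]
  have := sum_div_card_sq_le_sum_sq_div_card (s := Finset.univ) (f := fun k => (x k : ℝ) ^ p)
  simpa [powEmp_one_eq, pow_mul, div_eq_inv_mul] using this

variable {p} in
theorem linear_pow_le {a b y z : ℝ} (ha : 0 ≤ a) (hb : 0 ≤ b) (hy : 0 ≤ y) (hz : 0 ≤ z)
    (haK : a ≤ K) (hbK : b ≤ K) : (a * y + b * z) ^ p ≤ (2 * K) ^ p * (y ^ p + z ^ p) := by
  have hK : 0 ≤ K := ha.trans haK
  calc (a * y + b * z) ^ p ≤ (K * y + K * z) ^ p := by gcongr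
    _ = K ^ p * (y + z) ^ p := by rw [← mul_add, mul_pow]
    _ ≤ K ^ p * (2 ^ (p - 1) * (y ^ p + z ^ p)) := by
        gcongr
        exact add_pow_le hy hz p
    _ ≤ K ^ p * (2 ^ p * (y ^ p + z ^ p)) := by
        gcongr
        · exact one_le_two
        · exact p.sub_le 1
    _ = (2 * K) ^ p * (y ^ p + z ^ p) := by ring

theorem powEmp_jumpSite_sub (i : Fin N) (x : State N) :
    powEmp p f (jumpSite M i x) - powEmp p f x =
      (1 / N : ℝ) * (f (pos i) * ((M.c (pos i) * x i) ^ p - (x i : ℝ) ^ p)) := by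
  rw [powEmp, powEmp, ← mul_sub, sum_jumpSite_sub M (fun k y => (y : ℝ) ^ p * f (pos k))]
  push_cast
  ring

theorem powEmp_jumpPair_sub {i j : Fin N} (hji : j ≠ i) (x : State N) :
    powEmp p f (jumpPair M i j x) - powEmp p f x = (1 / N : ℝ) *
      (f (pos i) *
        ((M.a₁ (pos i, pos j) * x i + M.a₂ (pos i, pos j) * x j) ^ p - (x i : ℝ) ^ p) +
      f (pos j) *
        ((M.a₃ (pos i, pos j) * x i + M.a₄ (pos i, pos j) * x j) ^ p - (x j : ℝ) ^ p)) := by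
  rw [powEmp, powEmp, ← mul_sub, sum_jumpPair_sub M (fun k y => (y : ℝ) ^ p * f (pos k)) hji]
  push_cast
  ring

theorem abs_powEmp_jumpSite_sub_le (hK : M.BoundedBy K) (i : Fin N) (x : State N) :
    |powEmp p f (jumpSite M i x) - powEmp p f x| ≤
      2 * (2 * K) ^ p * ‖f‖ * (1 / N) * (x i : ℝ) ^ p := by
  have hK0 : 0 ≤ K := zero_le_one.trans hK.one_le
  have hK1 : 1 ≤ (2 * K) ^ p := one_le_pow₀ (by linarith [hK.one_le])
  have hpow : |(M.c (pos i) * x i : ℝ) ^ p - (x i : ℝ) ^ p| ≤ (2 * K) ^ p * (x i : ℝ) ^ p := by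
    refine abs_sub_le_of_nonneg_of_le (by positivity) ?_ (by positivity)
      (le_mul_of_one_le_left (by positivity) hK1)
    rw [mul_pow]
    gcongr
    linarith [hK.c_le (pos i)]
  rw [powEmp_jumpSite_sub, abs_mul, abs_mul, abs_of_nonneg (by positivity : (0 : ℝ) ≤ 1 / N)]
  calc (1 / N : ℝ) * (|f (pos i)| * |(M.c (pos i) * x i : ℝ) ^ p - (x i : ℝ) ^ p|)
      ≤ (1 / N) * (‖f‖ * ((2 * K) ^ p * (x i : ℝ) ^ p)) := by
        gcongr
        exact f.norm_coe_le_norm _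
    _ ≤ 2 * ((1 / N) * (‖f‖ * ((2 * K) ^ p * (x i : ℝ) ^ p))) :=
        le_mul_of_one_le_left (by positivity) one_le_two
    _ = 2 * (2 * K) ^ p * ‖f‖ * (1 / N) * (x i : ℝ) ^ p := by ring

theorem abs_powEmp_jumpPair_sub_le (hK : M.BoundedBy K) {i j : Fin N} (hji : j ≠ i)
    (x : State N) :
    |powEmp p f (jumpPair M i j x) - powEmp p f x| ≤
      2 * (2 * K) ^ p * ‖f‖ * (1 / N) * (x i : ℝ) ^ p +
        2 * (2 * K) ^ p * ‖f‖ * (1 / N) * (x j : ℝ) ^ p := by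
  have hK1 : 1 ≤ (2 * K) ^ p := one_le_pow₀ (by linarith [hK.one_le])
  set Y := (x i : ℝ) ^ p + (x j : ℝ) ^ p with hY
  have hi : 0 ≤ (x i : ℝ) ^ p := by positivity
  have hj : 0 ≤ (x j : ℝ) ^ p := by positivity
  have hpow {a b : ℝ≥0} (ha : (a : ℝ) ≤ K) (hb : (b : ℝ) ≤ K) {y : ℝ} (hy0 : 0 ≤ y) (hy : y ≤ Y) :
      |(a * x i + b * x j : ℝ) ^ p - y| ≤ (2 * K) ^ p * Y :=
    abs_sub_le_of_nonneg_of_le (by positivity)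
      (linear_pow_le a.2 b.2 (x i).2 (x j).2 ha hb) hy0
      (hy.trans (le_mul_of_one_le_left (add_nonneg hi hj) hK1))
  have hf (u : I) {r : ℝ} (hr : |r| ≤ (2 * K) ^ p * Y) : |f u * r| ≤ ‖f‖ * ((2 * K) ^ p * Y) := by
    rw [abs_mul]
    exact mul_le_mul (f.norm_coe_le_norm u) hr (abs_nonneg r) (norm_nonneg f)
  rw [powEmp_jumpPair_sub p f hji, abs_mul, abs_of_nonneg (by positivity : (0 : ℝ) ≤ 1 / N)]
  calc _ ≤ (1 / N : ℝ) * (‖f‖ * ((2 * K) ^ p * Y) + ‖f‖ * ((2 * K) ^ p * Y)) := by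
        gcongr
        refine (abs_add_le _ _).trans (add_le_add (hf _ ?_) (hf _ ?_))
        · exact hpow (hK.a₁_le _) (hK.a₂_le _) hi (le_add_of_nonneg_right hj)
        · exact hpow (hK.a₃_le _) (hK.a₄_le _) hj (le_add_of_nonneg_left hi)
    _ = _ := by
        rw [hY]
        ring

theorem gen_powEmp_one_le (hK : M.BoundedBy K) (x : State N) :
    gen M (powEmp p 1) x ≤ 6 * K * (2 * K) ^ p * powEmp p 1 x := by
  have hK0 : 0 ≤ K := zero_le_one.trans hK.one_le
  rw [gen_apply]
  refine (jumpSum_le hK (fun i => ?_)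
    (fun i => (le_abs_self _).trans (abs_powEmp_jumpSite_sub_le p 1 hK i x))
    fun i j hji => (le_abs_self _).trans (abs_powEmp_jumpPair_sub_le p 1 hK hji x)).trans_eq ?_
  · positivity
  · rw [← Finset.mul_sum, powEmp_one_eq, norm_one]
    ring

theorem gam_powEmp_le (hK : M.BoundedBy K) (x : State N) :
    gam M (powEmp p f) x ≤ 24 * K * (2 * K) ^ (p * 2) * ‖f‖ ^ 2 / N * powEmp (p * 2) 1 x := by
  have : 0 ≤ K := zero_le_one.trans hK.one_le
  set C := 2 * (2 * K) ^ p * ‖f‖ * (1 / N) with hC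
  have hsite (i : Fin N) :
      (powEmp p f (jumpSite M i x) - powEmp p f x) ^ 2 ≤ 2 * C ^ 2 * ((x i : ℝ) ^ p) ^ 2 := by
    rw [← sq_abs]
    calc _ ≤ (C * (x i : ℝ) ^ p) ^ 2 :=
          pow_le_pow_left₀ (abs_nonneg _) (abs_powEmp_jumpSite_sub_le p f hK i x) 2
      _ ≤ 2 * C ^ 2 * ((x i : ℝ) ^ p) ^ 2 := by nlinarith [sq_nonneg (C * (x i : ℝ) ^ p)]
  have hpair (i j : Fin N) (hji : j ≠ i) :
      (powEmp p f (jumpPair M i j x) - powEmp p f x) ^ 2 ≤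
        2 * C ^ 2 * ((x i : ℝ) ^ p) ^ 2 + 2 * C ^ 2 * ((x j : ℝ) ^ p) ^ 2 := by
    rw [← sq_abs]
    calc _ ≤ (C * (x i : ℝ) ^ p + C * (x j : ℝ) ^ p) ^ 2 :=
          pow_le_pow_left₀ (abs_nonneg _) (abs_powEmp_jumpPair_sub_le p f hK hji x) 2
      _ ≤ 2 * ((C * (x i : ℝ) ^ p) ^ 2 + (C * (x j : ℝ) ^ p) ^ 2) := add_sq_le
      _ = _ := by ring
  refine (jumpSum_le hK (fun i => by positivity) hsite hpair).trans_eq ?_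
  rw [← Finset.mul_sum, powEmp_one_eq, hC]
  simp only [pow_mul, div_eq_mul_inv]
  ring

section Moments

variable {Ω : Type*} [MeasurableSpace Ω] {P : Measure Ω}
  [IsProbabilityMeasure P] {X : ℝ≥0 → Ω → State N} (hX : IsLinearSystem M N P X)
  (h0 : ∀ᵐ ω ∂P, ∀ i, X 0 ω i ≤ 1)

include hX h0

theorem expect_powEmp_one_le (hK : M.BoundedBy K) {t : ℝ} (ht : 0 ≤ t) :
    expect P X t (powEmp p 1) ≤ Real.exp (6 * K * (2 * K) ^ p * t) := by
  have hmem : powEmp p 1 ∈ polyGrowth N := powEmp_mem_polyGrowth p 1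
  have init : expect P X 0 (powEmp p 1) ≤ 1 := by
    rw [expect, Real.toNNReal_zero]
    refine (integral_mono_ae (integrable_of_mem_polyGrowth hX h0 hmem 0) (integrable_const 1)
      (h0.mono fun ω hω => ?_)).trans_eq (by simp)
    have hsum : ∑ k, (X 0 ω k : ℝ) ^ p ≤ N := by
      simpa using Finset.sum_le_card_nsmul Finset.univ _ 1 fun k _ =>
        pow_le_one₀ (X 0 ω k).2 (NNReal.coe_le_one.2 (hω k))
    change powEmp p 1 (X 0 ω) ≤ 1
    rw [powEmp_one_eq, one_div_mul_eq_div]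
    exact div_le_one_of_le₀ hsum N.cast_nonneg
  have growth (s : ℝ) : expect P X s (gen M (powEmp p 1)) ≤
      6 * K * (2 * K) ^ p * expect P X s (powEmp p 1) + 0 := by
    rw [← expect_smul, add_zero]
    exact expect_mono hX h0 (gen_mem_polyGrowth M hmem) (Subalgebra.smul_mem _ hmem _)
      (gen_powEmp_one_le p hK) s
  calc expect P X t (powEmp p 1)
      ≤ gronwallBound (expect P X 0 (powEmp p 1)) (6 * K * (2 * K) ^ p) 0 t :=
        le_gronwallBound_of_hasDerivWithinAt (T := t)
          (fun s hs => (hasDerivWithinAt_expect hX h0 hmem hs.1).mono Set.Icc_subset_Ici_self)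
          (fun s _ => growth s) ⟨ht, le_rfl⟩
    _ ≤ Real.exp (6 * K * (2 * K) ^ p * t) := by
        rw [gronwallBound_ε0]
        exact mul_le_of_le_one_left (Real.exp_nonneg _) init

end Moments

end PowerAverages

section SecondMoment

variable {M : Coeffs} {N : ℕ} {Ω : Type*} [MeasurableSpace Ω] {P : Measure Ω}
  [IsProbabilityMeasure P] {X : ℝ≥0 → Ω → State N} (hX : IsLinearSystem M N P X)
  (h0 : ∀ᵐ ω ∂P, ∀ i, X 0 ω i ≤ 1) {ι : Type*} [Fintype ι] {φ : ι → State N → ℝ}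
  {α α' : ι → ℝ → ℝ} {T : ℝ}

theorem gam_mem_polyGrowth (M : Coeffs) {f : State N → ℝ} (hf : f ∈ polyGrowth N) :
    gam M f ∈ polyGrowth N := by
  have : gam M f = gen M (f ^ 2) - (2 : ℝ) • (f * gen M f) := by
    ext x
    simp only [Pi.sub_apply, Pi.smul_apply, Pi.mul_apply, gen_sq, smul_eq_mul]
    ring
  rw [this]
  exact sub_mem (gen_mem_polyGrowth M (pow_mem hf 2))
    (Subalgebra.smul_mem _ (mul_mem hf (gen_mem_polyGrowth M hf)) _)

include hX h0

theorem hasDerivWithinAt_expect_sum (hφ : ∀ a, φ a ∈ polyGrowth N) {t : ℝ}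
    (ht : t ∈ Set.Icc 0 T) (hα : ∀ a, HasDerivWithinAt (α a) (α' a t) (Set.Icc 0 T) t) :
    HasDerivWithinAt (fun s => expect P X s (∑ a, α a s • φ a))
      (expect P X t (∑ a, α' a t • φ a + gen M (∑ a, α a t • φ a))) (Set.Icc 0 T) t := by
  have expand (c : ι → ℝ) {χ : ι → State N → ℝ} (hχ : ∀ a, χ a ∈ polyGrowth N) (s : ℝ) :
      expect P X s (∑ a, c a • χ a) = ∑ a, c a * expect P X s (χ a) := by
    rw [expect_sum hX h0 _ fun a _ => Subalgebra.smul_mem _ (hχ a) _]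
    exact Finset.sum_congr rfl fun a _ => expect_smul _ _ _
  have hgen (a : ι) : gen M (φ a) ∈ polyGrowth N := gen_mem_polyGrowth M (hφ a)
  have hmem {χ : ι → State N → ℝ} (hχ : ∀ a, χ a ∈ polyGrowth N) (c : ι → ℝ) :
      ∑ a, c a • χ a ∈ polyGrowth N := sum_mem fun a _ => Subalgebra.smul_mem _ (hχ a) _
  have hderiv := HasDerivWithinAt.fun_sum (u := Finset.univ) fun a _ =>
    (hα a).mul ((hasDerivWithinAt_expect hX h0 (hφ a) ht.1).mono Set.Icc_subset_Ici_self)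
  simp only [map_sum, map_smul]
  rw [expect_add hX h0 (hmem hφ _) (hmem hgen _), expand _ hφ, expand _ hgen,
    ← Finset.sum_add_distrib]
  simp only [expand _ hφ]
  exact hderiv

theorem hasDerivWithinAt_expect_sq_sum (hφ : ∀ a, φ a ∈ polyGrowth N) {t : ℝ}
    (ht : t ∈ Set.Icc 0 T) (hα : ∀ a, HasDerivWithinAt (α a) (α' a t) (Set.Icc 0 T) t) :
    HasDerivWithinAt (fun s => expect P X s ((∑ a, α a s • φ a) ^ 2))
      (expect P X t (2 * (∑ a, α a t • φ a) * ∑ a, α' a t • φ a +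
        gen M ((∑ a, α a t • φ a) ^ 2))) (Set.Icc 0 T) t := by
  have prod_eq (c c' : ι → ℝ) : ∑ ab : ι × ι, (c ab.1 * c' ab.2) • (φ ab.1 * φ ab.2) =
      (∑ a, c a • φ a) * ∑ a, c' a • φ a := by
    rw [Fintype.sum_mul_sum, ← Fintype.sum_prod_type']
    exact Finset.sum_congr rfl fun ab _ => (smul_mul_smul_comm _ _ _ _).symm
  have sq_eq (s : ℝ) : ∑ ab : ι × ι, (α ab.1 s * α ab.2 s) • (φ ab.1 * φ ab.2) =
      (∑ a, α a s • φ a) ^ 2 := by rw [prod_eq (α · s) (α · s), sq]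
  have sq_deriv : ∑ ab : ι × ι, (α' ab.1 t * α ab.2 t + α ab.1 t * α' ab.2 t) •
      (φ ab.1 * φ ab.2) = 2 * (∑ a, α a t • φ a) * ∑ a, α' a t • φ a := by
    simp only [add_smul, Finset.sum_add_distrib]
    rw [prod_eq (α' · t) (α · t), prod_eq (α · t) (α' · t)]
    ring
  have := hasDerivWithinAt_expect_sum hX h0 (fun ab : ι × ι => mul_mem (hφ ab.1) (hφ ab.2)) ht
    (α := fun ab s => α ab.1 s * α ab.2 s)
    (α' := fun ab s => α' ab.1 s * α ab.2 s + α ab.1 s * α' ab.2 s)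
    fun ab => (hα ab.1).mul (hα ab.2)
  simpa only [sq_eq, sq_deriv] using this

theorem expect_gen_sq_add_le {ψ ψ' : State N → ℝ} (hψ : ψ ∈ polyGrowth N)
    (hψ' : ψ' ∈ polyGrowth N) (t : ℝ) :
    expect P X t (2 * ψ * ψ' + gen M (ψ ^ 2)) ≤
      expect P X t (ψ ^ 2) + expect P X t ((ψ' + gen M ψ) ^ 2 + gam M ψ) := by
  have hsq := pow_mem hψ 2
  have herr : (ψ' + gen M ψ) ^ 2 + gam M ψ ∈ polyGrowth N :=
    add_mem (pow_mem (add_mem hψ' (gen_mem_polyGrowth M hψ)) 2) (gam_mem_polyGrowth M hψ)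
  rw [← expect_add hX h0 hsq herr]
  refine expect_mono hX h0 (add_mem ?_ (gen_mem_polyGrowth M hsq)) (add_mem hsq herr)
    (fun x => ?_) t
  · exact mul_mem (mul_mem (algebraMap_mem (polyGrowth N) (2 : ℝ)) hψ) hψ'
  · simp only [Pi.add_apply, Pi.mul_apply, Pi.pow_apply, Pi.ofNat_apply, gen_sq]
    nlinarith [sq_nonneg (ψ x - (ψ' x + gen M ψ x))]

/-- The observable `ψ s = ∑ₐ α a s • φ a` varies with time; `∂ₛψ + L ψ` is its drift. -/
theorem expect_sq_sum_le (hφ : ∀ a, φ a ∈ polyGrowth N)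
    (hα : ∀ a, ∀ s ∈ Set.Icc 0 T, HasDerivWithinAt (α a) (α' a s) (Set.Icc 0 T) s) {δ : ℝ}
    (hδ : ∀ s ∈ Set.Icc 0 T, expect P X s ((∑ a, α' a s • φ a + gen M (∑ a, α a s • φ a)) ^ 2 +
      gam M (∑ a, α a s • φ a)) ≤ δ) {t : ℝ} (ht : t ∈ Set.Icc 0 T) :
    expect P X t ((∑ a, α a t • φ a) ^ 2) ≤
      gronwallBound (expect P X 0 ((∑ a, α a 0 • φ a) ^ 2)) 1 δ t := by
  have hψ (c : ι → ℝ) : ∑ a, c a • φ a ∈ polyGrowth N :=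
    sum_mem fun a _ => Subalgebra.smul_mem _ (hφ a) _
  refine le_gronwallBound_of_hasDerivWithinAt
    (f := fun s => expect P X s ((∑ a, α a s • φ a) ^ 2))
    (fun s hs => hasDerivWithinAt_expect_sq_sum hX h0 hφ hs fun a => hα a s hs)
    (fun s hs => ?_) ht
  rw [one_mul]
  exact (expect_gen_sq_add_le hX h0 (hψ _) (hψ _) s).trans (add_le_add_right (hδ s hs) _)

/-- A martingale estimate: up to the fluctuations `Γ (powEmp p (f s))`, the mean square of
`powEmp p (f s) - c s` is controlled by that of its drift. -/
theorem expect_powEmp_sub_sq_le (p : ℕ) {f f' : ℝ → C(I, ℝ)} {c c' : ℝ → ℝ}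
    (hf : ∀ s ∈ Set.Icc 0 T, HasDerivWithinAt f (f' s) (Set.Icc 0 T) s)
    (hc : ∀ s ∈ Set.Icc 0 T, HasDerivWithinAt c (c' s) (Set.Icc 0 T) s) {δ : ℝ}
    (hδ : ∀ s ∈ Set.Icc 0 T, expect P X s (fun x =>
      (powEmp p (f' s) x - c' s + gen M (powEmp p (f s)) x) ^ 2 + gam M (powEmp p (f s)) x) ≤ δ)
    {t : ℝ} (ht : t ∈ Set.Icc 0 T) :
    expect P X t (fun x => (powEmp p (f t) x - c t) ^ 2) ≤
      gronwallBound (expect P X 0 fun x => (powEmp p (f 0) x - c 0) ^ 2) 1 δ t := by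
  let φ : Option (Fin N) → State N → ℝ := fun a => a.elim 1 fun k x => (x k : ℝ) ^ p
  let coeff (g : C(I, ℝ)) (r : ℝ) (a : Option (Fin N)) : ℝ :=
    a.elim (-r) fun k => (1 / N : ℝ) * g (pos k)
  have sum_eq (g : C(I, ℝ)) (r : ℝ) :
      ∑ a, coeff g r a • φ a = fun x => powEmp p g x - r := by
    ext x
    simp [φ, coeff, Fintype.sum_option, powEmp_eq_sum, ← sub_eq_neg_add]
  have gen_eq (g : C(I, ℝ)) (r : ℝ) :
      gen M (fun x : State N => powEmp p g x - r) = gen M (powEmp p g) := by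
    ext x
    simp [gen_apply]
  have gam_eq (g : C(I, ℝ)) (r : ℝ) :
      gam M (fun x : State N => powEmp p g x - r) = gam M (powEmp p g) := by
    ext x
    simp [gam]
  have key := expect_sq_sum_le hX h0 (φ := φ) (α := fun a s => coeff (f s) (c s) a)
    (α' := fun a s => coeff (f' s) (c' s) a) (T := T) (δ := δ) ?_ ?_ ?_ ht
  · simp only [sum_eq] at key
    exact key
  · rintro (_ | k)
    · exact one_mem _
    · exact pow_mem (coord_mem_polyGrowth k) p
  · rintro (_ | k) s hs
    · exact (hc s hs).neg
    · exact ((ContinuousMap.evalCLM ℝ (pos k)).hasFDerivAt.comp_hasDerivWithinAt s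
        (hf s hs)).const_mul (1 / N : ℝ)
  · simp only [sum_eq, gen_eq, gam_eq]
    exact hδ

end SecondMoment

section RiemannSums

/-- The Riemann sum of mesh `1 / N` of `∫ f`, over the positions of the sites. -/
def riemann (N : ℕ) (f : C(I, ℝ)) : ℝ := (1 / N : ℝ) * ∑ i : Fin N, f (pos i)

theorem integral_unitInterval_eq (f : C(I, ℝ)) :
    ∫ u, f u = ∫ x in (0 : ℝ)..1, f (Set.projIcc 0 1 zero_le_one x) := by
  rw [intervalIntegral.integral_of_le zero_le_one, ← integral_Icc_eq_integral_Ioc,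
    ← integral_subtype measurableSet_Icc]
  simp

theorem continuous_comp_projIcc (f : C(I, ℝ)) :
    Continuous fun x => f (Set.projIcc 0 1 zero_le_one x) :=
  f.continuous.comp continuous_projIcc

theorem integral_unitInterval_eq_sum {N : ℕ} (hN : 0 < N) (f : C(I, ℝ)) :
    ∫ u, f u = ∑ i : Fin N, ∫ x in ((i : ℝ) / N)..(((i : ℝ) + 1) / N),
      f (Set.projIcc 0 1 zero_le_one x) := by
  have key := intervalIntegral.sum_integral_adjacent_intervals (μ := volume)
    (a := fun k : ℕ => (k : ℝ) / N) (n := N) fun k _ =>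
    (continuous_comp_projIcc f).intervalIntegrable _ _
  push_cast at key
  have hN' : (N : ℝ) ≠ 0 := by exact_mod_cast hN.ne'
  rw [integral_unitInterval_eq, Fin.sum_univ_eq_sum_range (fun k : ℕ =>
    ∫ x in ((k : ℝ) / N)..(((k : ℝ) + 1) / N), f (Set.projIcc 0 1 zero_le_one x)), key,
    zero_div, div_self hN']

theorem abs_sub_integral_cell_le {N : ℕ} {f : C(I, ℝ)} {ε : ℝ}
    (hf : ∀ u v, dist u v ≤ 1 / N → |f u - f v| ≤ ε) (i : Fin N) :
    |(1 / N : ℝ) * f (pos i) - ∫ x in ((i : ℝ) / N)..(((i : ℝ) + 1) / N),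
      f (Set.projIcc 0 1 zero_le_one x)| ≤ (1 / N : ℝ) * ε := by
  have length_eq : ((i : ℝ) + 1) / N - (i : ℝ) / N = 1 / N := by ring
  have hle : (i : ℝ) / N ≤ ((i : ℝ) + 1) / N := by gcongr; linarith
  have hconst : (1 / N : ℝ) * f (pos i) =
      ∫ _ in ((i : ℝ) / N)..(((i : ℝ) + 1) / N), f (pos i) := by
    rw [intervalIntegral.integral_const, length_eq, smul_eq_mul]
  rw [hconst, ← intervalIntegral.integral_sub intervalIntegrable_const
    ((continuous_comp_projIcc f).intervalIntegrable _ _)]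
  refine (intervalIntegral.norm_integral_le_of_norm_le_const (E := ℝ) (C := ε)
    fun x hx => ?_).trans_eq ?_
  · rw [Set.uIoc_of_le hle] at hx
    have hxI : x ∈ Set.Icc (0 : ℝ) 1 :=
      ⟨(by positivity : (0 : ℝ) ≤ (i : ℝ) / N).trans hx.1.le, hx.2.trans (pos i).2.2⟩
    rw [Set.projIcc_of_mem _ hxI]
    refine hf _ _ ?_
    change |((i : ℝ) + 1) / N - x| ≤ 1 / N
    rw [abs_of_nonneg (sub_nonneg.2 hx.2)]
    linarith [hx.1]
  · rw [length_eq, abs_of_nonneg (by positivity), mul_comm]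

theorem abs_riemann_sub_integral_le {N : ℕ} (hN : 0 < N) {f : C(I, ℝ)} {ε : ℝ}
    (hf : ∀ u v, dist u v ≤ 1 / N → |f u - f v| ≤ ε) : |riemann N f - ∫ u, f u| ≤ ε := by
  have hN' : (N : ℝ) ≠ 0 := by exact_mod_cast hN.ne'
  rw [integral_unitInterval_eq_sum hN, riemann, Finset.mul_sum, ← Finset.sum_sub_distrib]
  calc _ ≤ ∑ _ : Fin N, (1 / N : ℝ) * ε :=
        (Finset.abs_sum_le_sum_abs _ _).trans
          (Finset.sum_le_sum fun i _ => abs_sub_integral_cell_le hf i)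
    _ = ε := by simp [hN']

theorem exists_equicontinuity_modulus {S : Set C(I, ℝ)} (hS : IsCompact S) {ε : ℝ} (hε : 0 < ε) :
    ∃ δ > 0, ∀ f ∈ S, ∀ u v, dist u v < δ → |f u - f v| ≤ ε := by
  have huc := (hS.prod isCompact_univ).uniformContinuousOn_of_continuous
    (f := fun z : C(I, ℝ) × I => z.1 z.2) (by fun_prop)
  obtain ⟨δ, hδ, h⟩ := Metric.uniformContinuousOn_iff.1 huc ε hε
  refine ⟨δ, hδ, fun f hf u v huv => ?_⟩
  exact (h (f, u) ⟨hf, Set.mem_univ u⟩ (f, v) ⟨hf, Set.mem_univ v⟩ (by simpa [Prod.dist_eq])).le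

theorem eventually_abs_riemann_sub_integral_le {S : Set C(I, ℝ)} (hS : IsCompact S) {ε : ℝ}
    (hε : 0 < ε) : ∀ᶠ N in atTop, ∀ f ∈ S, |riemann N f - ∫ u, f u| ≤ ε := by
  obtain ⟨δ, hδ, h⟩ := exists_equicontinuity_modulus hS hε
  filter_upwards [(tendsto_const_div_atTop_nhds_zero_nat (1 : ℝ)).eventually_lt_const hδ,
    eventually_gt_atTop 0] with N hNδ hN f hf
  exact abs_riemann_sub_integral_le hN fun u v huv => h f hf u v (huv.trans_lt hNδ)

end RiemannSums

section DriftOperators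

theorem kernelOp_add (k k' : C(I × I, ℝ)) : kernelOp (k + k') = kernelOp k + kernelOp k' := by
  ext f u
  have := integral_add (integrable_C (k.curry u * f)) (integrable_C (k'.curry u * f))
  simpa [kernelOp_apply, add_mul] using this

theorem mulOp_add (g g' : C(I, ℝ)) : mulOp (g + g') = mulOp g + mulOp g' := map_add _ _ _

theorem densityFunctional_add (g g' : C(I, ℝ)) :
    densityFunctional (g + g') = densityFunctional g + densityFunctional g' := by
  simp only [densityFunctional, mulOp_add, ContinuousLinearMap.comp_add]

theorem integral_mul_kernelOp (k : C(I × I, ℝ)) (f g : C(I, ℝ)) :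
    ∫ u, f u * kernelOp k g u = ∫ u, kernelOp (swapK k) f u * g u := by
  simp only [kernelOp_apply, ← integral_const_mul, ← integral_mul_const]
  rw [integral_integral_swap]
  · refine integral_congr_ae (Eventually.of_forall fun v => integral_congr_ae
      (Eventually.of_forall fun u => ?_))
    simp only [swapK, ContinuousMap.comp_apply, ContinuousMap.coe_mk, Prod.swap_prod_mk]
    ring
  · have : Continuous (Function.uncurry fun u v : I => f u * (k (u, v) * g v)) := by
      unfold Function.uncurry
      fun_prop
    exact this.integrable_of_hasCompactSupport (HasCompactSupport.of_compactSpace _)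

/-- The operator `f ↦ m f + f ∫ q(·, v) dv + ∫ κ(·, v) f(v) dv`, the common shape of `hydroOp`
and `P₂`. -/
def mulKernelOp (m : C(I, ℝ)) (q κ : C(I × I, ℝ)) : C(I, ℝ) →L[ℝ] C(I, ℝ) :=
  mulOp (m + kernelOp q 1) + kernelOp κ

theorem mulKernelOp_apply (m : C(I, ℝ)) (q κ : C(I × I, ℝ)) (f : C(I, ℝ)) (u : I) :
    mulKernelOp m q κ f u = m u * f u + f u * (∫ v, q.curry u v) + ∫ v, (κ.curry u * f) v := by
  simp [mulKernelOp, mulOp, kernelOp_apply, mul_comm]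

theorem densityFunctional_mulKernelOp (m : C(I, ℝ)) (q κ : C(I × I, ℝ)) (r f : C(I, ℝ)) :
    densityFunctional r (mulKernelOp m q κ f) =
      densityFunctional (mulKernelOp m q (swapK κ) r) f := by
  rw [mulKernelOp, mulKernelOp, add_apply, add_apply, map_add, densityFunctional_add, add_apply]
  congr 1
  · rw [densityFunctional_apply, densityFunctional_apply]
    refine integral_congr_ae (Eventually.of_forall fun u => ?_)
    simp only [mulOp, ContinuousLinearMap.mul_apply', ContinuousMap.mul_apply]
    ring
  · exact integral_mul_kernelOp κ r f

/-- The multiplier `m` of `driftOp`, seen as a `mulKernelOp`;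
it comes from the jumps at one site. -/
def driftMul (M : Coeffs) (p : ℕ) : C(I, ℝ) := (toR M.c ^ p - 1) * toR M.b

/-- The potential kernel `q` of `driftOp`: what the two participants of an interaction keep of their
own content. -/
def driftPot (M : Coeffs) (p : ℕ) : C(I × I, ℝ) :=
  toR M.lam * (toR M.a₁ ^ p - 1) + swapK (toR M.lam * (toR M.a₄ ^ p - 1))

/-- The exchange kernel `κ` of `driftOp`: what the two participants of an interaction receive from
each other. -/
def driftKer (M : Coeffs) (p : ℕ) : C(I × I, ℝ) :=
  swapK (toR M.lam * toR M.a₂ ^ p) + toR M.lam * toR M.a₃ ^ p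

/-- The operator driving the averages of `p`-th powers in the limit, up to the mixed products
collected in `crossTerm`. -/
def driftOp (M : Coeffs) (p : ℕ) : C(I, ℝ) →L[ℝ] C(I, ℝ) :=
  mulKernelOp (driftMul M p) (driftPot M p) (driftKer M p)

theorem driftOp_two (M : Coeffs) : driftOp M 2 = P₂ M := by
  simp only [driftOp, mulKernelOp, driftMul, driftPot, driftKer, P₂, P₃, P₄, P₅, P₆, P₇, mulOp_add,
    kernelOp_add, add_apply]
  abel

theorem densityFunctional_driftOp_one (M : Coeffs) (r f : C(I, ℝ)) :
    densityFunctional r (driftOp M 1 f) = densityFunctional (hydroOp M r) f := by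
  have : hydroOp M = mulKernelOp (driftMul M 1) (driftPot M 1) (swapK (driftKer M 1)) := by
    have swapK_add (k k' : C(I × I, ℝ)) : swapK (k + k') = swapK k + swapK k' := rfl
    have swapK_swapK (k : C(I × I, ℝ)) : swapK (swapK k) = k := rfl
    simp only [mulKernelOp, driftMul, driftPot, driftKer, hydroOp, mulOp_add, kernelOp_add,
      add_apply, pow_one, swapK_add, swapK_swapK, mul_comm (toR M.b)]
    abel
  rw [this, driftOp, densityFunctional_mulKernelOp]

/-- The kernel of the interaction term in the drift of the squares. -/
def crossKer (M : Coeffs) : C(I × I, ℝ) :=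
  toR M.a₁ * toR M.a₂ * toR M.lam + swapK (toR M.lam * toR M.a₃ * toR M.a₄)

theorem lOne_eq (M : Coeffs) (r : C(I, ℝ)) :
    lOne M r = (2 : ℝ) • densityFunctional (r * kernelOp (crossKer M) r) := by
  rw [lOne, crossKer, kernelOp_add, ← smul_add, ← densityFunctional_add, add_apply, mul_add]

end DriftOperators

section Drift

variable (M : Coeffs) {N : ℕ} (p : ℕ) (f : C(I, ℝ)) (x : State N)

/-- The part of the drift of `powEmp p f` coming from the mixed products in the binomial
expansion of `(a₁ x(i) + a₂ x(j))ᵖ` and `(a₃ x(i) + a₄ x(j))ᵖ`. -/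
def crossTerm : ℝ :=
  (1 / N : ℝ) * ((1 / N : ℝ) * ∑ i : Fin N, ∑ j ∈ Finset.univ.filter (fun j => j ≠ i),
    (M.lam (pos i, pos j) : ℝ) *
      (f (pos i) * ((M.a₁ (pos i, pos j) * x i + M.a₂ (pos i, pos j) * x j) ^ p -
        (M.a₁ (pos i, pos j) : ℝ) ^ p * (x i : ℝ) ^ p -
        (M.a₂ (pos i, pos j) : ℝ) ^ p * (x j : ℝ) ^ p) +
      f (pos j) * ((M.a₃ (pos i, pos j) * x i + M.a₄ (pos i, pos j) * x j) ^ p -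
        (M.a₃ (pos i, pos j) : ℝ) ^ p * (x i : ℝ) ^ p -
        (M.a₄ (pos i, pos j) : ℝ) ^ p * (x j : ℝ) ^ p)))

/-- The contribution of the pair `(i, j)` to the drift of `powEmp p f` without mixed products. -/
def pairDrift (i j : Fin N) : ℝ :=
  (M.lam (pos i, pos j) : ℝ) *
    (f (pos i) * (((M.a₁ (pos i, pos j) : ℝ) ^ p - 1) * (x i : ℝ) ^ p +
      (M.a₂ (pos i, pos j) : ℝ) ^ p * (x j : ℝ) ^ p) +
    f (pos j) * ((M.a₃ (pos i, pos j) : ℝ) ^ p * (x i : ℝ) ^ p +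
      ((M.a₄ (pos i, pos j) : ℝ) ^ p - 1) * (x j : ℝ) ^ p))

theorem sum_sum_ne (F : Fin N → Fin N → ℝ) :
    ∑ i, ∑ j ∈ Finset.univ.filter (fun j => j ≠ i), F i j = ∑ i, ∑ j, F i j - ∑ i, F i i := by
  rw [← Finset.sum_sub_distrib]
  refine Finset.sum_congr rfl fun i _ => ?_
  rw [Finset.filter_ne', eq_sub_iff_add_eq, Finset.sum_erase_add _ _ (Finset.mem_univ i)]

theorem driftMul_apply (u : I) : driftMul M p u = ((M.c u : ℝ) ^ p - 1) * M.b u := by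
  simp [driftMul, toR]

theorem driftPot_apply (u v : I) :
    driftPot M p (u, v) = M.lam (u, v) * ((M.a₁ (u, v) : ℝ) ^ p - 1) +
      M.lam (v, u) * ((M.a₄ (v, u) : ℝ) ^ p - 1) := by
  simp [driftPot, swapK, toR]

theorem driftKer_apply (u v : I) :
    driftKer M p (u, v) = M.lam (v, u) * (M.a₂ (v, u) : ℝ) ^ p +
      M.lam (u, v) * (M.a₃ (u, v) : ℝ) ^ p := by
  simp [driftKer, swapK, toR]

theorem gen_powEmp_eq_crossTerm_add :
    gen M (powEmp p f) x = crossTerm M p f x +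
      ((1 / N : ℝ) * ∑ i, (x i : ℝ) ^ p * (driftMul M p (pos i) * f (pos i)) +
      (1 / N : ℝ) * ((1 / N : ℝ) *
        ∑ i, ∑ j ∈ Finset.univ.filter (fun j => j ≠ i), pairDrift M p f x i j)) := by
  rw [gen_apply, jumpSum_apply, add_left_comm, crossTerm]
  congr 1
  · rw [Finset.mul_sum]
    refine Finset.sum_congr rfl fun i _ => ?_
    rw [powEmp_jumpSite_sub, driftMul_apply, mul_pow]
    ring
  · simp_rw [← mul_add, ← Finset.sum_add_distrib, Finset.mul_sum]
    refine Finset.sum_congr rfl fun i _ => Finset.sum_congr rfl fun j hj => ?_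
    rw [powEmp_jumpPair_sub p f (Finset.mem_filter.1 hj).2, pairDrift]
    ring

theorem sum_pairDrift :
    ∑ i, ∑ j, pairDrift M p f x i j =
      ∑ i, (x i : ℝ) ^ p * ∑ j : Fin N, (f (pos i) * driftPot M p (pos i, pos j) +
        driftKer M p (pos i, pos j) * f (pos j)) := by
  let A (i j : Fin N) : ℝ := (M.lam (pos i, pos j) : ℝ) *
    (f (pos i) * ((M.a₁ (pos i, pos j) : ℝ) ^ p - 1) +
      f (pos j) * (M.a₃ (pos i, pos j) : ℝ) ^ p)
  let B (i j : Fin N) : ℝ := (M.lam (pos i, pos j) : ℝ) *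
    (f (pos i) * (M.a₂ (pos i, pos j) : ℝ) ^ p +
      f (pos j) * ((M.a₄ (pos i, pos j) : ℝ) ^ p - 1))
  calc ∑ i, ∑ j, pairDrift M p f x i j
      = ∑ i, ∑ j, (x i : ℝ) ^ p * A i j + ∑ i, ∑ j, (x j : ℝ) ^ p * B i j := by
        simp_rw [← Finset.sum_add_distrib]
        refine Finset.sum_congr rfl fun i _ => Finset.sum_congr rfl fun j _ => ?_
        simp only [A, B, pairDrift]
        ring
    _ = ∑ i, ∑ j, (x i : ℝ) ^ p * A i j + ∑ i, ∑ j, (x i : ℝ) ^ p * B j i := by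
        rw [Finset.sum_comm (f := fun i j => (x j : ℝ) ^ p * B i j)]
    _ = _ := by
        simp_rw [← Finset.sum_add_distrib, Finset.mul_sum]
        refine Finset.sum_congr rfl fun i _ => Finset.sum_congr rfl fun j _ => ?_
        simp only [A, B, driftPot_apply, driftKer_apply]
        ring

theorem gen_powEmp :
    gen M (powEmp p f) x = crossTerm M p f x +
      (1 / N : ℝ) * ∑ i, (x i : ℝ) ^ p * (driftMul M p (pos i) * f (pos i) +
        f (pos i) * riemann N ((driftPot M p).curry (pos i)) +
        riemann N ((driftKer M p).curry (pos i) * f) -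
        (1 / N : ℝ) * (f (pos i) *
          (driftPot M p (pos i, pos i) + driftKer M p (pos i, pos i)))) := by
  rw [gen_powEmp_eq_crossTerm_add, sum_sum_ne, sum_pairDrift, add_right_inj, ← mul_add, mul_sub,
    Finset.mul_sum _ _ (1 / N : ℝ), Finset.mul_sum _ _ (1 / N : ℝ), ← Finset.sum_sub_distrib,
    ← Finset.sum_add_distrib]
  congr 1
  refine Finset.sum_congr rfl fun i _ => ?_
  simp only [riemann, ContinuousMap.curry_apply, ContinuousMap.mul_apply, pairDrift,
    Finset.sum_add_distrib, ← Finset.mul_sum, driftPot_apply M p (pos i) (pos i),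
    driftKer_apply M p (pos i) (pos i)]
  ring

end Drift

section DriftApproximation

theorem exists_pos_norm_bound {S : Set C(I, ℝ)} (hS : IsCompact S) :
    ∃ R : ℝ, 0 < R ∧ ∀ f ∈ S, ‖f‖ ≤ R := by
  obtain ⟨R, hR⟩ := hS.isBounded.exists_norm_le
  exact ⟨max R 1, by positivity, fun f hf => (hR f hf).trans (le_max_left _ _)⟩

theorem eventually_div_le (D : ℝ) {ε : ℝ} (hε : 0 < ε) : ∀ᶠ N : ℕ in atTop, D / N ≤ ε :=
  (tendsto_const_div_atTop_nhds_zero_nat D).eventually_le_const hε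

theorem isCompact_image_curry_mul (k : C(I × I, ℝ)) {S : Set C(I, ℝ)} (hS : IsCompact S) :
    IsCompact ((fun z : I × C(I, ℝ) => k.curry z.1 * z.2) '' (Set.univ ×ˢ S)) :=
  (isCompact_univ.prod hS).image (by fun_prop)

theorem gen_powEmp_sub_eq (M : Coeffs) {N : ℕ} (p : ℕ) (f : C(I, ℝ)) (x : State N) :
    gen M (powEmp p f) x - powEmp p (driftOp M p f) x - crossTerm M p f x =
      (1 / N : ℝ) * ∑ i, (x i : ℝ) ^ p *
        (f (pos i) * (riemann N ((driftPot M p).curry (pos i)) -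
          ∫ v, (driftPot M p).curry (pos i) v) +
        (riemann N ((driftKer M p).curry (pos i) * f) -
          ∫ v, ((driftKer M p).curry (pos i) * f) v) -
        (1 / N : ℝ) * (f (pos i) *
          (driftPot M p (pos i, pos i) + driftKer M p (pos i, pos i)))) := by
  rw [gen_powEmp, powEmp, sub_right_comm, add_sub_cancel_left, ← mul_sub, ← Finset.sum_sub_distrib]
  congr 1
  refine Finset.sum_congr rfl fun i _ => ?_
  rw [driftOp, mulKernelOp_apply]
  ring

theorem eventually_abs_gen_powEmp_sub_le (M : Coeffs) (p : ℕ) {S : Set C(I, ℝ)} (hS : IsCompact S)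
    {ε : ℝ} (hε : 0 < ε) : ∀ᶠ N in atTop, ∀ f ∈ S, ∀ x : State N,
      |gen M (powEmp p f) x - powEmp p (driftOp M p f) x - crossTerm M p f x| ≤
        ε * powEmp p 1 x := by
  obtain ⟨R, hR, hSR⟩ := exists_pos_norm_bound hS
  have hpot : IsCompact (Set.range (driftPot M p).curry) :=
    isCompact_range (driftPot M p).curry.continuous
  filter_upwards [eventually_abs_riemann_sub_integral_le hpot (by positivity : 0 < ε / (3 * R)),
    eventually_abs_riemann_sub_integral_le (isCompact_image_curry_mul (driftKer M p) hS)
      (by positivity : 0 < ε / 3),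
    eventually_div_le (R * (‖driftPot M p‖ + ‖driftKer M p‖)) (by positivity : 0 < ε / 3)]
    with N h_pot h_ker h_diag f hf x
  rw [gen_powEmp_sub_eq]
  refine abs_average_pow_mul_le p (fun i => ?_) x
  have hfR : |f (pos i)| ≤ R := (f.norm_coe_le_norm _).trans (hSR f hf)
  have pot_le : |f (pos i) * (riemann N ((driftPot M p).curry (pos i)) -
      ∫ v, (driftPot M p).curry (pos i) v)| ≤ ε / 3 := by
    rw [abs_mul]
    calc _ ≤ R * (ε / (3 * R)) :=
          mul_le_mul hfR (h_pot _ ⟨pos i, rfl⟩) (abs_nonneg _) hR.le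
      _ = ε / 3 := by field_simp
  have ker_le := h_ker _ ⟨(pos i, f), ⟨Set.mem_univ _, hf⟩, rfl⟩
  have diag_le : |(1 / N : ℝ) * (f (pos i) *
      (driftPot M p (pos i, pos i) + driftKer M p (pos i, pos i)))| ≤ ε / 3 := by
    refine le_trans ?_ h_diag
    rw [abs_mul, abs_mul, abs_of_nonneg (by positivity : (0 : ℝ) ≤ 1 / N),
      div_eq_inv_mul (_ * _), one_div]
    gcongr
    exact (abs_add_le _ _).trans (add_le_add ((driftPot M p).norm_coe_le_norm _)
      ((driftKer M p).norm_coe_le_norm _))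
  refine (abs_sub _ _).trans ((add_le_add (abs_add_le _ _) le_rfl).trans ?_)
  linarith

end DriftApproximation

/-- The random variables `ψ N a t (X^N t)` converge to `0` in `L²`, uniformly in `a ∈ S` and
`t ∈ [0, T]`. Polynomial growth of the `ψ N a t` guarantees that the expectations exist. -/
structure MeanSquareNegligible {Ω : ℕ → Type*} [∀ N, MeasurableSpace (Ω N)]
    (P : ∀ N, Measure (Ω N)) (X : ∀ N, ℝ≥0 → Ω N → State N) (T : ℝ) {κ : Type*} (S : Set κ)
    (ψ : ∀ N, κ → ℝ → State N → ℝ) : Prop where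
  mem_polyGrowth : ∀ N a t, ψ N a t ∈ polyGrowth N
  eventually_le : ∀ ε > 0, ∀ᶠ N in atTop, ∀ a ∈ S, ∀ t ∈ Set.Icc 0 T,
    expect (P N) (X N) t (ψ N a t ^ 2) ≤ ε

section LawOfLargeNumbers

variable {M : Coeffs} {Ω : ℕ → Type*} [∀ N, MeasurableSpace (Ω N)] {P : ∀ N, Measure (Ω N)}
  [∀ N, IsProbabilityMeasure (P N)] {X : ∀ N, ℝ≥0 → Ω N → State N}
  (hX : ∀ N, 1 ≤ N → IsLinearSystem M N (P N) (X N))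
  (h0 : ∀ N, 1 ≤ N → ∀ᵐ ω ∂P N, ∀ i, X N 0 ω i ≤ 1)
  {T : ℝ} {κ κ' : Type*} {S : Set κ} {ψ χ : ∀ N, κ → ℝ → State N → ℝ}

omit [∀ N, IsProbabilityMeasure (P N)] in
theorem MeanSquareNegligible.reindex {S' : Set κ'} {ψ : ∀ N, κ' → ℝ → State N → ℝ}
    (hψ : MeanSquareNegligible P X T S' ψ) {τ : κ → ℝ → κ'}
    (hτ : ∀ a ∈ S, ∀ t ∈ Set.Icc 0 T, τ a t ∈ S') :
    MeanSquareNegligible P X T S fun N a t => ψ N (τ a t) t where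
  mem_polyGrowth N a t := hψ.mem_polyGrowth N (τ a t) t
  eventually_le ε hε := (hψ.eventually_le ε hε).mono fun _ h a ha t ht => h _ (hτ a ha t ht) t ht

omit [∀ N, IsProbabilityMeasure (P N)] in
theorem MeanSquareNegligible.const_smul (hψ : MeanSquareNegligible P X T S ψ) (r : ℝ) :
    MeanSquareNegligible P X T S fun N a t => r • ψ N a t where
  mem_polyGrowth N a t := Subalgebra.smul_mem _ (hψ.mem_polyGrowth N a t) r
  eventually_le ε hε := by
    filter_upwards [hψ.eventually_le (ε / (r ^ 2 + 1)) (by positivity)] with N h a ha t ht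
    rw [smul_pow, expect_smul]
    calc r ^ 2 * expect (P N) (X N) t (ψ N a t ^ 2) ≤ r ^ 2 * (ε / (r ^ 2 + 1)) := by
          gcongr
          exact h a ha t ht
      _ ≤ ε := by
          rw [← mul_div_assoc, div_le_iff₀ (by positivity)]
          nlinarith

include hX h0

theorem MeanSquareNegligible.of_sq_le
    (hψ : ∀ N a t, ψ N a t ∈ polyGrowth N) {B : ∀ N, κ → ℝ → State N → ℝ}
    (hB : ∀ N a t, B N a t ∈ polyGrowth N)
    (hle : ∀ ε > 0, ∀ᶠ N in atTop, ∀ a ∈ S, ∀ t ∈ Set.Icc 0 T,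
      (∀ x, ψ N a t x ^ 2 ≤ B N a t x) ∧ expect (P N) (X N) t (B N a t) ≤ ε) :
    MeanSquareNegligible P X T S ψ where
  mem_polyGrowth := hψ
  eventually_le ε hε := by
    filter_upwards [hle ε hε, eventually_ge_atTop 1] with N h hN a ha t ht
    exact (expect_mono (hX N hN) (h0 N hN) (pow_mem (hψ N a t) 2) (hB N a t)
      (h a ha t ht).1 t).trans (h a ha t ht).2

theorem MeanSquareNegligible.add (hψ : MeanSquareNegligible P X T S ψ)
    (hχ : MeanSquareNegligible P X T S χ) :
    MeanSquareNegligible P X T S fun N a t => ψ N a t + χ N a t := by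
  have hψ2 (N a t) := pow_mem (hψ.mem_polyGrowth N a t) 2
  have hχ2 (N a t) := pow_mem (hχ.mem_polyGrowth N a t) 2
  refine .of_sq_le hX h0 (fun N a t => add_mem (hψ.mem_polyGrowth N a t) (hχ.mem_polyGrowth N a t))
    (B := fun N a t => (2 : ℝ) • (ψ N a t ^ 2 + χ N a t ^ 2))
    (fun N a t => Subalgebra.smul_mem _ (add_mem (hψ2 N a t) (hχ2 N a t)) _) fun ε hε => ?_
  filter_upwards [hψ.eventually_le (ε / 4) (by positivity),
    hχ.eventually_le (ε / 4) (by positivity), eventually_ge_atTop 1] with N h h' hN a ha t ht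
  refine ⟨fun x => add_sq_le, ?_⟩
  rw [expect_smul, expect_add (hX N hN) (h0 N hN) (hψ2 N a t) (hχ2 N a t)]
  linarith [h a ha t ht, h' a ha t ht]

theorem exists_expect_powEmp_one_le (p : ℕ) (T : ℝ) :
    ∃ C > 0, ∀ N, 1 ≤ N → ∀ t ∈ Set.Icc 0 T, expect (P N) (X N) t (powEmp p 1) ≤ C := by
  obtain ⟨K, hK⟩ := M.exists_boundedBy
  have hK0 : 0 ≤ K := zero_le_one.trans hK.one_le
  refine ⟨Real.exp (6 * K * (2 * K) ^ p * T), Real.exp_pos _, fun N hN t ht => ?_⟩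
  refine (expect_powEmp_one_le p (hX N hN) (h0 N hN) hK ht.1).trans ?_
  gcongr
  exact ht.2

theorem MeanSquareNegligible.of_abs_le (p : ℕ) (hψ : ∀ N a t, ψ N a t ∈ polyGrowth N)
    (hle : ∀ ε > 0, ∀ᶠ N in atTop, ∀ a ∈ S, ∀ t ∈ Set.Icc 0 T, ∀ x,
      |ψ N a t x| ≤ ε * powEmp p 1 x) : MeanSquareNegligible P X T S ψ := by
  obtain ⟨C, hC, hmoment⟩ := exists_expect_powEmp_one_le hX h0 (p * 2) T
  refine .of_sq_le hX h0 hψ (B := fun N a t => fun x => ψ N a t x ^ 2) (fun N a t =>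
    pow_mem (hψ N a t) 2) fun ε hε => ?_
  filter_upwards [hle √(ε / C) (by positivity), eventually_ge_atTop 1] with N h hN a ha t ht
  refine ⟨fun x => le_rfl, ?_⟩
  calc expect (P N) (X N) t (fun x => ψ N a t x ^ 2)
      ≤ expect (P N) (X N) t ((ε / C) • powEmp (p * 2) 1) := by
        refine expect_mono (hX N hN) (h0 N hN) (pow_mem (hψ N a t) 2)
          (Subalgebra.smul_mem _ (powEmp_mem_polyGrowth _ _) _) (fun x => ?_) t
        change ψ N a t x ^ 2 ≤ ε / C * powEmp (p * 2) 1 x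
        rw [← sq_abs]
        calc |ψ N a t x| ^ 2 ≤ (√(ε / C) * powEmp p 1 x) ^ 2 := by
              gcongr
              exact h a ha t ht x
          _ = ε / C * powEmp p 1 x ^ 2 := by rw [mul_pow, Real.sq_sqrt (by positivity)]
          _ ≤ ε / C * powEmp (p * 2) 1 x := by
              gcongr
              exact powEmp_one_sq_le p x
    _ ≤ ε / C * C := by
        rw [expect_smul]
        gcongr
        exact hmoment N hN t ht
    _ = ε := div_mul_cancel₀ ε hC.ne'

theorem eventually_expect_gam_le (p : ℕ) {S : Set C(I, ℝ)} (hS : IsCompact S) (T : ℝ) {ε : ℝ}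
    (hε : 0 < ε) : ∀ᶠ N in atTop, ∀ f ∈ S, ∀ t ∈ Set.Icc 0 T,
      expect (P N) (X N) t (gam M (powEmp p f)) ≤ ε := by
  obtain ⟨K, hK⟩ := M.exists_boundedBy
  obtain ⟨R, _, hSR⟩ := exists_pos_norm_bound hS
  obtain ⟨C, hC, hmoment⟩ := exists_expect_powEmp_one_le hX h0 (p * 2) T
  have hK0 : 0 ≤ K := zero_le_one.trans hK.one_le
  filter_upwards [eventually_div_le (24 * K * (2 * K) ^ (p * 2) * R ^ 2 * C) hε,
    eventually_ge_atTop 1] with N hN hN1 f hf t ht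
  calc expect (P N) (X N) t (gam M (powEmp p f))
      ≤ expect (P N) (X N) t
          ((24 * K * (2 * K) ^ (p * 2) * ‖f‖ ^ 2 / N) • powEmp (p * 2) 1) :=
        expect_mono (hX N hN1) (h0 N hN1) (gam_mem_polyGrowth M (powEmp_mem_polyGrowth p f))
          (Subalgebra.smul_mem _ (powEmp_mem_polyGrowth _ _) _) (gam_powEmp_le p f hK) t
    _ ≤ 24 * K * (2 * K) ^ (p * 2) * ‖f‖ ^ 2 / N * C := by
        rw [expect_smul]
        gcongr
        exact hmoment N hN1 t ht
    _ ≤ 24 * K * (2 * K) ^ (p * 2) * R ^ 2 / N * C := by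
        gcongr
        exact hSR f hf
    _ ≤ ε := by rwa [div_mul_eq_mul_div]

end LawOfLargeNumbers

section BackwardFlow

section Exponential

variable {E : Type*} [NormedAddCommGroup E] [NormedSpace ℝ E]

theorem opExp_zero_smul (A : E →L[ℝ] E) (f : E) : opExp ((0 : ℝ) • A) f = f := by
  simp [opExp]

variable [CompleteSpace E]

theorem continuous_opExp_smul_apply (A : E →L[ℝ] E) :
    Continuous fun z : ℝ × E => opExp (z.1 • A) z.2 := by
  have : Continuous fun s : ℝ => opExp (s • A) := continuous_iff_continuousAt.2 fun t =>
    (hasDerivAt_exp_smul_const (𝕂 := ℝ) A t).continuousAt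
  exact (this.comp continuous_fst).clm_apply continuous_snd

theorem hasDerivAt_opExp_sub_smul_apply (A : E →L[ℝ] E) (f : E) (t s : ℝ) :
    HasDerivAt (fun s : ℝ => opExp ((t - s) • A) f) (-(A (opExp ((t - s) • A) f))) s := by
  have key : HasDerivAt (fun r : ℝ => opExp (r • A) f) (A (opExp ((t - s) • A) f)) (t - s) := by
    simpa [opExp] using
      (hasDerivAt_exp_smul_const' (𝕂 := ℝ) A (t - s)).clm_apply (hasDerivAt_const (t - s) f)
  simpa [Function.comp_def] using key.scomp s ((hasDerivAt_id s).const_sub t)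

end Exponential

variable {M : Coeffs} {N : ℕ} {Ω : Type*} [MeasurableSpace Ω] {P : Measure Ω}
  [IsProbabilityMeasure P] {X : ℝ≥0 → Ω → State N} (hX : IsLinearSystem M N P X)
  (h0 : ∀ᵐ ω ∂P, ∀ i, X 0 ω i ≤ 1)

include hX h0

/-- Along the backward flow `f s = exp ((t - s) A) g` the function `s ↦ θ s (f s)` has derivative
`h s (f s)`, so that only the error in the drift contributes. -/
theorem expect_powEmp_sub_sq_le_of_backwardFlow (p : ℕ) {A : C(I, ℝ) →L[ℝ] C(I, ℝ)} {T : ℝ}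
    {θ h : ℝ → StrongDual ℝ C(I, ℝ)}
    (hθ : ∀ s ∈ Set.Icc 0 T, HasDerivWithinAt θ (adj A (θ s) + h s) (Set.Icc 0 T) s)
    (g : C(I, ℝ)) {t δ : ℝ} (ht : t ∈ Set.Icc 0 T)
    (hδ : ∀ s ∈ Set.Icc 0 t, ∀ f, f = opExp ((t - s) • A) g → expect P X s
      ((fun x => gen M (powEmp p f) x - powEmp p (A f) x - h s f) ^ 2 + gam M (powEmp p f)) ≤ δ) :
    expect P X t (fun x => (powEmp p g x - θ t g) ^ 2) ≤ gronwallBound (expect P X 0 fun x =>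
      (powEmp p (opExp (t • A) g) x - θ 0 (opExp (t • A) g)) ^ 2) 1 δ t := by
  let f (s : ℝ) : C(I, ℝ) := opExp ((t - s) • A) g
  have hf (s : ℝ) : HasDerivWithinAt f (-A (f s)) (Set.Icc 0 t) s :=
    (hasDerivAt_opExp_sub_smul_apply A g t s).hasDerivWithinAt
  have hc (s : ℝ) (hs : s ∈ Set.Icc 0 t) :
      HasDerivWithinAt (fun s => θ s (f s)) (h s (f s)) (Set.Icc 0 t) s := by
    have hθs : HasDerivWithinAt (F := StrongDual ℝ C(I, ℝ)) θ (adj A (θ s) + h s)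
        (Set.Icc 0 t) s :=
      HasDerivWithinAt.mono (F := StrongDual ℝ C(I, ℝ)) (hθ s ⟨hs.1, hs.2.trans ht.2⟩)
        (Set.Icc_subset_Icc_right ht.2)
    refine (hθs.clm_apply (hf s)).congr_deriv ?_
    simp [adj]
  have key := expect_powEmp_sub_sq_le hX h0 p (fun s _ => hf s) hc (δ := δ) (fun s hs => ?_)
    (Set.right_mem_Icc.2 ht.1)
  · simpa only [f, sub_self, sub_zero, opExp_zero_smul] using key
  · refine le_of_eq_of_le (congrArg _ (funext fun x => ?_)) (hδ s hs (f s) rfl)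
    simp only [Pi.add_apply, Pi.pow_apply]
    have : powEmp p (-A (f s)) x = -powEmp p (A (f s)) x := by simp [powEmp]
    rw [this]
    ring

end BackwardFlow

section LawOfLargeNumbers

variable {M : Coeffs} {Ω : ℕ → Type*} [∀ N, MeasurableSpace (Ω N)] {P : ∀ N, Measure (Ω N)}
  [∀ N, IsProbabilityMeasure (P N)] {X : ∀ N, ℝ≥0 → Ω N → State N}
  (hX : ∀ N, 1 ≤ N → IsLinearSystem M N (P N) (X N))
  (h0 : ∀ N, 1 ≤ N → ∀ᵐ ω ∂P N, ∀ i, X N 0 ω i ≤ 1)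

include hX h0

theorem MeanSquareNegligible.powEmp_sub (p : ℕ) {A : C(I, ℝ) →L[ℝ] C(I, ℝ)} {T : ℝ}
    {θ h : ℝ → StrongDual ℝ C(I, ℝ)}
    (hθ : ∀ s ∈ Set.Icc 0 T, HasDerivWithinAt θ (adj A (θ s) + h s) (Set.Icc 0 T) s)
    (hinit : ∀ S : Set C(I, ℝ), IsCompact S → ∀ ε > 0, ∀ᶠ N in atTop, ∀ f ∈ S,
      expect (P N) (X N) 0 (fun x => (powEmp p f x - θ 0 f) ^ 2) ≤ ε)
    (hdrift : ∀ S : Set C(I, ℝ), IsCompact S → MeanSquareNegligible P X T S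
      fun _ f s x => gen M (powEmp p f) x - powEmp p (A f) x - h s f)
    {S : Set C(I, ℝ)} (hS : IsCompact S) :
    MeanSquareNegligible P X T S fun _ f t x => powEmp p f x - θ t f where
  mem_polyGrowth N f t := sub_mem (powEmp_mem_polyGrowth p f) (const_mem_polyGrowth _)
  eventually_le ε hε := by
    let S' := (fun z : ℝ × C(I, ℝ) => opExp (z.1 • A) z.2) '' (Set.Icc 0 T ×ˢ S)
    have hS' : IsCompact S' :=
      (isCompact_Icc.prod hS).image_of_continuousOn (continuous_opExp_smul_apply A).continuousOn
    have hmem {g : C(I, ℝ)} (hg : g ∈ S) {r : ℝ} (hr : r ∈ Set.Icc 0 T) :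
        opExp (r • A) g ∈ S' := ⟨(r, g), ⟨hr, hg⟩, rfl⟩
    obtain ⟨η, hη, hηε⟩ : ∃ η > 0, η * (2 * Real.exp T) = ε :=
      ⟨ε / (2 * Real.exp T), by positivity, by field_simp⟩
    filter_upwards [hinit S' hS' η hη, (hdrift S' hS').eventually_le (η / 2) (by positivity),
      eventually_expect_gam_le hX h0 p hS' T (by positivity : 0 < η / 2), eventually_ge_atTop 1]
      with N h_init h_drift h_gam hN g hg t ht
    refine (expect_powEmp_sub_sq_le_of_backwardFlow (hX N hN) (h0 N hN) p hθ g ht (δ := η)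
      ?_).trans ?_
    · rintro s hs _ rfl
      have hsT : s ∈ Set.Icc 0 T := ⟨hs.1, hs.2.trans ht.2⟩
      have hf := hmem hg (r := t - s) ⟨sub_nonneg.2 hs.2, by linarith [hs.1, ht.2]⟩
      rw [expect_add (hX N hN) (h0 N hN) (pow_mem ((hdrift S' hS').mem_polyGrowth N _ s) 2)
        (gam_mem_polyGrowth M (powEmp_mem_polyGrowth p _))]
      linarith [h_drift _ hf s hsT, h_gam _ hf s hsT]
    · simp only [gronwallBound_of_K_ne_0 one_ne_zero, one_mul, div_one]
      rw [← hηε]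
      have := h_init _ (hmem hg ht)
      have := Real.exp_le_exp.2 ht.2
      have := Real.exp_pos t
      nlinarith

end LawOfLargeNumbers

section InitialState

theorem integral_sub_const_sq_eq {Ω : Type*} [MeasurableSpace Ω] {P : Measure Ω}
    [IsProbabilityMeasure P] {Y : Ω → ℝ} (hY : MemLp Y 2 P) (c : ℝ) :
    ∫ ω, (Y ω - c) ^ 2 ∂P = Var[Y; P] + (∫ ω, Y ω ∂P - c) ^ 2 := by
  have key := variance_eq_sub (hY.sub (memLp_const c))
  have hmean : ∫ ω, (Y - fun _ : Ω => c) ω ∂P = ∫ ω, Y ω ∂P - c := by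
    simp only [Pi.sub_apply]
    rw [integral_sub (hY.integrable one_le_two) (integrable_const c)]
    simp
  rw [hmean] at key
  rw [← variance_sub_const hY.aestronglyMeasurable c]
  exact sub_eq_iff_eq_add.1 key.symm

namespace IsInitialState

variable {φ : C(I, ℝ)} {N : ℕ} {Ω : Type*} [MeasurableSpace Ω] {P : Measure Ω}
  [IsProbabilityMeasure P] {X₀ : Ω → State N}

theorem ae_eq_zero_or_eq_one (h : IsInitialState φ N P X₀) (hm : Measurable X₀) :
    ∀ᵐ ω ∂P, ∀ i, X₀ ω i = 0 ∨ X₀ ω i = 1 := by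
  rw [ae_all_iff]
  intro i
  have hmi : Measurable fun ω => X₀ ω i := (measurable_pi_apply i).comp hm
  have h0 : MeasurableSet {ω | X₀ ω i = 0} := hmi (measurableSet_singleton 0)
  have h1 : MeasurableSet {ω | X₀ ω i = 1} := hmi (measurableSet_singleton 1)
  have hdisj : Disjoint {ω | X₀ ω i = 0} {ω | X₀ ω i = 1} :=
    Set.disjoint_left.2 fun ω (hω : X₀ ω i = 0) (hω' : X₀ ω i = 1) =>
      zero_ne_one (hω.symm.trans hω')
  have hunion : P.real ({ω | X₀ ω i = 0} ∪ {ω | X₀ ω i = 1}) = 1 := by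
    rw [measureReal_union hdisj h1, h.prob_one, h.prob_zero, sub_add_cancel]
  rw [measureReal_def, ENNReal.toReal_eq_one_iff] at hunion
  exact (prob_compl_eq_zero_iff (h0.union h1)).2 hunion

theorem ae_le_one (h : IsInitialState φ N P X₀) (hm : Measurable X₀) :
    ∀ᵐ ω ∂P, ∀ i, X₀ ω i ≤ 1 := by
  filter_upwards [h.ae_eq_zero_or_eq_one hm] with ω hω i
  rcases hω i with h | h <;> simp [h]

theorem integral_pow (h : IsInitialState φ N P X₀) (hm : Measurable X₀) {p : ℕ} (hp : p ≠ 0)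
    (i : Fin N) : ∫ ω, (X₀ ω i : ℝ) ^ p ∂P = φ (pos i) := by
  have h1 : MeasurableSet {ω | X₀ ω i = 1} :=
    (measurable_pi_apply i).comp hm (measurableSet_singleton 1)
  rw [← h.prob_one i, ← integral_indicator_one h1]
  refine integral_congr_ae ?_
  filter_upwards [h.ae_eq_zero_or_eq_one hm] with ω hω
  rcases hω i with h | h <;> simp [Set.indicator, h, hp]

theorem ae_mem_Icc_weighted_pow (h : IsInitialState φ N P X₀) (hm : Measurable X₀) (p : ℕ)
    (f : C(I, ℝ)) (i : Fin N) :
    ∀ᵐ ω ∂P, (1 / N : ℝ) * f (pos i) * (X₀ ω i : ℝ) ^ p ∈ Set.Icc (-(‖f‖ / N)) (‖f‖ / N) := by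
  filter_upwards [h.ae_le_one hm] with ω hω
  have hpow : |(X₀ ω i : ℝ) ^ p| ≤ 1 := by
    rw [abs_of_nonneg (by positivity)]
    exact pow_le_one₀ (X₀ ω i).2 (hω i)
  rw [Set.mem_Icc, ← abs_le, abs_mul, abs_mul, abs_of_nonneg (by positivity : (0 : ℝ) ≤ 1 / N),
    one_div, mul_assoc, div_eq_inv_mul]
  exact mul_le_mul_of_nonneg_left
    ((mul_le_of_le_one_right (abs_nonneg _) hpow).trans (f.norm_coe_le_norm _)) (by positivity)

theorem memLp_weighted_pow (h : IsInitialState φ N P X₀) (hm : Measurable X₀) (p : ℕ)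
    (f : C(I, ℝ)) (i : Fin N) :
    MemLp (fun ω => (1 / N : ℝ) * f (pos i) * (X₀ ω i : ℝ) ^ p) 2 P :=
  memLp_of_bounded (h.ae_mem_Icc_weighted_pow hm p f i) (by fun_prop) 2

theorem memLp_powEmp (h : IsInitialState φ N P X₀) (hm : Measurable X₀) (p : ℕ) (f : C(I, ℝ)) :
    MemLp (fun ω => powEmp p f (X₀ ω)) 2 P := by
  simp only [powEmp_eq_sum]
  exact memLp_finsetSum _ fun i _ => h.memLp_weighted_pow hm p f i

theorem integral_powEmp (h : IsInitialState φ N P X₀) (hm : Measurable X₀) {p : ℕ} (hp : p ≠ 0)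
    (f : C(I, ℝ)) : ∫ ω, powEmp p f (X₀ ω) ∂P = riemann N (φ * f) := by
  simp only [powEmp_eq_sum]
  rw [integral_finsetSum _ fun i _ => (h.memLp_weighted_pow hm p f i).integrable one_le_two,
    riemann, Finset.mul_sum]
  refine Finset.sum_congr rfl fun i _ => ?_
  rw [integral_const_mul, h.integral_pow hm hp, ContinuousMap.mul_apply]
  ring

theorem variance_powEmp_le (h : IsInitialState φ N P X₀) (hm : Measurable X₀) (p : ℕ)
    (f : C(I, ℝ)) : Var[fun ω => powEmp p f (X₀ ω); P] ≤ ‖f‖ ^ 2 / N := by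
  let g (i : Fin N) (y : ℝ≥0) : ℝ := (1 / N : ℝ) * f (pos i) * (y : ℝ) ^ p
  have hg (i : Fin N) : Measurable (g i) :=
    (measurable_coe_nnreal_real.pow_const p).const_mul _
  have hsum : (fun ω => powEmp p f (X₀ ω)) = ∑ i, fun ω => g i (X₀ ω i) := funext fun ω => by
    rw [powEmp_eq_sum, Finset.sum_apply]
  rw [hsum, IndepFun.variance_sum (fun i _ => h.memLp_weighted_pow hm p f i)
    fun i _ j _ hij => (h.indep.indepFun hij).comp (hg i) (hg j)]
  calc ∑ i, Var[fun ω => g i (X₀ ω i); P] ≤ ∑ _ : Fin N, ((‖f‖ / N - -(‖f‖ / N)) / 2) ^ 2 :=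
        Finset.sum_le_sum fun i _ => variance_le_sq_of_bounded
          (h.ae_mem_Icc_weighted_pow hm p f i)
          (h.memLp_weighted_pow hm p f i).aestronglyMeasurable.aemeasurable
    _ = ‖f‖ ^ 2 / N := by
        rcases N.eq_zero_or_pos with rfl | hN
        · simp
        · rw [Finset.sum_const, Finset.card_univ, Fintype.card_fin, nsmul_eq_mul]
          field_simp
          ring

theorem integral_powEmp_sub_sq_le (h : IsInitialState φ N P X₀) (hm : Measurable X₀) {p : ℕ}
    (hp : p ≠ 0) (f : C(I, ℝ)) (c : ℝ) :
    ∫ ω, (powEmp p f (X₀ ω) - c) ^ 2 ∂P ≤ ‖f‖ ^ 2 / N + (riemann N (φ * f) - c) ^ 2 := by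
  rw [integral_sub_const_sq_eq (h.memLp_powEmp hm p f), h.integral_powEmp hm hp]
  gcongr
  exact h.variance_powEmp_le hm p f

end IsInitialState

theorem eventually_integral_powEmp_sub_sq_le {φ : C(I, ℝ)} {Ω : ℕ → Type*}
    [∀ N, MeasurableSpace (Ω N)] {P : ∀ N, Measure (Ω N)} [∀ N, IsProbabilityMeasure (P N)]
    {X₀ : ∀ N, Ω N → State N} (hm : ∀ N, 1 ≤ N → Measurable (X₀ N))
    (hX₀ : ∀ N, 1 ≤ N → IsInitialState φ N (P N) (X₀ N)) {p : ℕ} (hp : p ≠ 0)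
    {S : Set C(I, ℝ)} (hS : IsCompact S) {ε : ℝ} (hε : 0 < ε) :
    ∀ᶠ N in atTop, ∀ f ∈ S,
      ∫ ω, (powEmp p f (X₀ N ω) - densityFunctional φ f) ^ 2 ∂P N ≤ ε := by
  obtain ⟨R, _, hSR⟩ := exists_pos_norm_bound hS
  have hS' : IsCompact ((φ * ·) '' S) := hS.image (by fun_prop)
  filter_upwards [eventually_abs_riemann_sub_integral_le hS' (Real.sqrt_pos.2 (half_pos hε)),
    eventually_div_le (R ^ 2) (half_pos hε), eventually_ge_atTop 1] with N h_riemann h_var hN f hf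
  have bias_le : (riemann N (φ * f) - densityFunctional φ f) ^ 2 ≤ ε / 2 :=
    Real.sq_le (half_pos hε).le |>.2 (abs_le.1 (h_riemann _ ⟨f, hf, rfl⟩))
  have var_le : ‖f‖ ^ 2 / N ≤ R ^ 2 / N := by
    have := hSR f hf
    gcongr
  linarith [(hX₀ N hN).integral_powEmp_sub_sq_le (hm N hN) hp f (densityFunctional φ f)]

end InitialState

section LimitEquations

theorem opExp_smul_opExp_neg_smul {E : Type*} [NormedAddCommGroup E] [NormedSpace ℝ E]
    [CompleteSpace E] (A : E →L[ℝ] E) (t : ℝ) (f : E) :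
    opExp (t • A) (opExp ((-t) • A) f) = f := by
  let : NormedAlgebra ℚ (E →L[ℝ] E) := .restrictScalars ℚ ℝ _
  have : opExp (t • A) * opExp ((-t) • A) = 1 := by
    rw [opExp, opExp, ← NormedSpace.exp_add_of_commute]
    · simp
    · exact ((Commute.refl A).smul_left t).smul_right (-t)
  exact congrArg (· f) this

/-- Variation of constants. -/
theorem exists_hasDerivAt_clm_add {E : Type*} [NormedAddCommGroup E] [NormedSpace ℝ E]
    [CompleteSpace E] (A : E →L[ℝ] E) (x₀ : E) {g : ℝ → E} (hg : Continuous g) :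
    ∃ y : ℝ → E, y 0 = x₀ ∧ ∀ t, HasDerivAt y (A (y t) + g t) t := by
  have hc : Continuous fun s => opExp ((-s) • A) (g s) :=
    (continuous_opExp_smul_apply A).comp (continuous_neg.prodMk hg)
  refine ⟨fun t => opExp (t • A) (x₀ + ∫ s in (0 : ℝ)..t, opExp ((-s) • A) (g s)), ?_,
    fun t => ?_⟩
  · simp only [intervalIntegral.integral_same, add_zero]
    exact opExp_zero_smul A x₀
  · have := (hasDerivAt_exp_smul_const' (𝕂 := ℝ) A t).clm_apply
      ((hc.integral_hasStrictDerivAt 0 t).hasDerivAt.const_add x₀)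
    exact this.congr_deriv (congrArg _ (opExp_smul_opExp_neg_smul A t (g t)))

theorem exists_isHydroDensity (M : Coeffs) (φ : C(I, ℝ)) :
    ∃ ρ, IsHydroDensity M φ ρ ∧ Continuous ρ := by
  obtain ⟨ρ, hρ0, hρ⟩ := exists_hasDerivAt_clm_add (hydroOp M) φ continuous_zero
  refine ⟨ρ, ⟨hρ0, fun t _ => ?_⟩, continuous_iff_continuousAt.2 fun t => (hρ t).continuousAt⟩
  simpa using (hρ t).hasDerivWithinAt

theorem IsHydroDensity.continuousOn {M : Coeffs} {φ : C(I, ℝ)} {ρ : ℝ → C(I, ℝ)}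
    (h : IsHydroDensity M φ ρ) : ContinuousOn ρ (Set.Ici 0) :=
  fun s hs => (h.2 s hs).continuousWithinAt

theorem IsHydroDensity.eqOn {M : Coeffs} {φ : C(I, ℝ)} {ρ ρ' : ℝ → C(I, ℝ)}
    (h : IsHydroDensity M φ ρ) (h' : IsHydroDensity M φ ρ') : Set.EqOn ρ ρ' (Set.Ici 0) := by
  intro t ht
  have hd {τ : ℝ → C(I, ℝ)} (hτ : IsHydroDensity M φ τ) (s : ℝ) (hs : s ∈ Set.Ico 0 t) :
      HasDerivWithinAt τ (hydroOp M (τ s)) (Set.Ici s) s :=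
    (hτ.2 s hs.1).mono (Set.Ici_subset_Ici.2 hs.1)
  exact ODE_solution_unique (v := fun _ => hydroOp M) (fun _ => (hydroOp M).lipschitz)
    (h.continuousOn.mono Set.Icc_subset_Ici_self) (hd h)
    (h'.continuousOn.mono Set.Icc_subset_Ici_self) (hd h') (h.1.trans h'.1.symm)
    (Set.right_mem_Icc.2 ht)

theorem IsThetaSolution.eqOn {M : Coeffs} {φ : C(I, ℝ)} {ρ : ℝ → C(I, ℝ)} {T : ℝ}
    {θ θ' : ℝ → StrongDual ℝ C(I, ℝ)} (h : IsThetaSolution M φ ρ T θ)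
    (h' : IsThetaSolution M φ ρ T θ') : Set.EqOn θ θ' (Set.Icc 0 T) := by
  have hc {τ : ℝ → StrongDual ℝ C(I, ℝ)} (hτ : IsThetaSolution M φ ρ T τ) :
      ContinuousOn τ (Set.Icc 0 T) :=
    fun s hs => HasDerivWithinAt.continuousWithinAt (F := StrongDual ℝ C(I, ℝ)) (hτ.2 s hs)
  have hd {τ : ℝ → StrongDual ℝ C(I, ℝ)} (hτ : IsThetaSolution M φ ρ T τ) (s : ℝ)
      (hs : s ∈ Set.Ico 0 T) :
      HasDerivWithinAt τ (adj (P₂ M) (τ s) + lOne M (ρ s)) (Set.Ici s) s :=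
    HasDerivWithinAt.mono_of_mem_nhdsWithin (F := StrongDual ℝ C(I, ℝ))
      (hτ.2 s ⟨hs.1, hs.2.le⟩) (mem_of_superset (Icc_mem_nhdsGE hs.2)
        (Set.Icc_subset_Icc_left hs.1))
  refine ODE_solution_unique (E := StrongDual ℝ C(I, ℝ))
    (v := fun s τ => adj (P₂ M) τ + lOne M (ρ s)) (K := ‖P₂ M‖₊)
    (fun s => LipschitzWith.of_dist_le_mul fun τ τ' => ?_) (hc h) (hd h) (hc h') (hd h')
    (h.1.trans h'.1.symm)
  rw [dist_add_right, dist_eq_norm, dist_eq_norm, mul_comm]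
  exact (τ - τ').opNorm_comp_le (P₂ M)

theorem abs_densityFunctional_le (g f : C(I, ℝ)) : |densityFunctional g f| ≤ ‖g‖ * ‖f‖ :=
  (abs_integral_C_le (g * f)).trans (norm_mul_le g f)

/-- `densityFunctional` as a bounded operator. -/
def densityCLM : C(I, ℝ) →L[ℝ] StrongDual ℝ C(I, ℝ) :=
  LinearMap.mkContinuous
    { toFun := densityFunctional
      map_add' := densityFunctional_add
      map_smul' := fun r g => by
        ext f
        simp [densityFunctional_apply, mul_assoc, integral_const_mul] } 1
    (fun g => ContinuousLinearMap.opNorm_le_bound _ (by positivity) fun f => by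
      rw [one_mul]
      exact abs_densityFunctional_le g f)

theorem hasDerivWithinAt_densityFunctional {y : ℝ → C(I, ℝ)} {y' : C(I, ℝ)} {s : Set ℝ}
    {t : ℝ} (hy : HasDerivWithinAt y y' s t) :
    HasDerivWithinAt (fun t => densityFunctional (y t)) (densityFunctional y') s t :=
  HasFDerivAt.comp_hasDerivWithinAt (E := StrongDual ℝ C(I, ℝ)) t densityCLM.hasFDerivAt hy

theorem adj_P₂_densityFunctional (M : Coeffs) (g : C(I, ℝ)) :
    adj (P₂ M) (densityFunctional g) = densityFunctional
      (mulKernelOp (driftMul M 2) (driftPot M 2) (swapK (driftKer M 2)) g) := by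
  ext f
  rw [← densityFunctional_mulKernelOp, ← driftOp, driftOp_two]
  rfl

theorem exists_isThetaSolution_densityFunctional (M : Coeffs) (φ : C(I, ℝ)) {ρ : ℝ → C(I, ℝ)}
    (hρ : Continuous ρ) (T : ℝ) :
    ∃ y : ℝ → C(I, ℝ), IsThetaSolution M φ ρ T (fun t => densityFunctional (y t)) ∧
      Continuous y := by
  have hg : Continuous fun t => (2 : ℝ) • (ρ t * kernelOp (crossKer M) (ρ t)) := by fun_prop
  obtain ⟨y, hy0, hy⟩ := exists_hasDerivAt_clm_add
    (mulKernelOp (driftMul M 2) (driftPot M 2) (swapK (driftKer M 2))) φ hg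
  refine ⟨y, ⟨congrArg densityFunctional hy0, fun t _ => ?_⟩,
    continuous_iff_continuousAt.2 fun t => (hy t).continuousAt⟩
  rw [adj_P₂_densityFunctional, lOne_eq]
  refine HasDerivWithinAt.congr_deriv (𝕜 := ℝ) (F := StrongDual ℝ C(I, ℝ))
    (hasDerivWithinAt_densityFunctional (hy t).hasDerivWithinAt) ?_
  exact (map_add densityCLM _ _).trans (congrArg _ (map_smul densityCLM _ _))

end LimitEquations

section Fluctuations

variable (κ : C(I × I, ℝ)) (r f : C(I, ℝ)) {N : ℕ}

/-- The deviation of the first-order empirical measure from `r(u) du`, tested against `f`. -/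
def fluct (x : State N) : ℝ := powEmp 1 f x - densityFunctional r f

/-- The mean over the sites `i` of the squared deviation tested against `κ(i/N, ·)`. -/
def meanSqFluct : State N → ℝ := (1 / N : ℝ) • ∑ i : Fin N, fluct r (κ.curry (pos i)) ^ 2

/-- The integral of `u ↦ f(u) fluct r (κ(u, ·))` against the first-order empirical measure. -/
def weightedFluct (x : State N) : ℝ :=
  (1 / N : ℝ) * ∑ i : Fin N, (x i : ℝ) * (f (pos i) * fluct r (κ.curry (pos i)) x)

theorem fluct_mem_polyGrowth : fluct r f ∈ polyGrowth N :=
  sub_mem (powEmp_mem_polyGrowth 1 f) (const_mem_polyGrowth _)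

theorem meanSqFluct_mem_polyGrowth : meanSqFluct κ r ∈ polyGrowth N :=
  Subalgebra.smul_mem _ (sum_mem fun _ _ => pow_mem (fluct_mem_polyGrowth r _) 2) _

theorem weightedFluct_mem_polyGrowth : weightedFluct κ r f ∈ polyGrowth N := by
  have : weightedFluct κ r f = (1 / N : ℝ) • ∑ i : Fin N,
      (fun x : State N => (x i : ℝ)) * (f (pos i) • fluct r (κ.curry (pos i))) :=
    funext fun x => by
      simp only [weightedFluct, Pi.smul_apply, Finset.sum_apply, Pi.mul_apply, smul_eq_mul]
  rw [this]
  exact Subalgebra.smul_mem _ (sum_mem fun i _ => mul_mem (coord_mem_polyGrowth i)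
    (Subalgebra.smul_mem _ (fluct_mem_polyGrowth r _) _)) _

theorem meanSqFluct_apply (x : State N) :
    meanSqFluct κ r x = (1 / N : ℝ) * ∑ i : Fin N, fluct r (κ.curry (pos i)) x ^ 2 := by
  simp [meanSqFluct]

theorem meanSqFluct_nonneg (x : State N) : 0 ≤ meanSqFluct κ r x := by
  rw [meanSqFluct_apply]
  positivity

theorem fluct_sq_le (x : State N) :
    fluct r f x ^ 2 ≤ 2 * ‖f‖ ^ 2 * (powEmp 2 1 x + ‖r‖ ^ 2) := by
  have h_emp : powEmp 1 f x ^ 2 ≤ ‖f‖ ^ 2 * powEmp 2 1 x := by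
    calc powEmp 1 f x ^ 2 = |powEmp 1 f x| ^ 2 := (sq_abs _).symm
      _ ≤ (‖f‖ * powEmp 1 1 x) ^ 2 := by
          gcongr
          exact abs_average_pow_mul_le 1 (fun k => f.norm_coe_le_norm (pos k)) x
      _ ≤ ‖f‖ ^ 2 * powEmp 2 1 x := by
          rw [mul_pow]
          gcongr
          exact powEmp_one_sq_le 1 x
  have h_lim : densityFunctional r f ^ 2 ≤ ‖f‖ ^ 2 * ‖r‖ ^ 2 := by
    rw [← sq_abs, ← mul_pow, mul_comm ‖f‖]
    gcongr
    exact abs_densityFunctional_le r f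
  rw [fluct]
  nlinarith [sq_nonneg (powEmp 1 f x + densityFunctional r f)]

theorem norm_curry_le (u : I) : ‖κ.curry u‖ ≤ ‖κ‖ :=
  (ContinuousMap.norm_le _ (norm_nonneg κ)).2 fun v => κ.norm_coe_le_norm (u, v)

theorem meanSqFluct_le (x : State N) :
    meanSqFluct κ r x ≤ 2 * ‖κ‖ ^ 2 * (powEmp 2 1 x + ‖r‖ ^ 2) := by
  have := powEmp_one_nonneg 2 x
  rw [meanSqFluct_apply]
  calc (1 / N : ℝ) * ∑ i : Fin N, fluct r (κ.curry (pos i)) x ^ 2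
      ≤ (1 / N : ℝ) * ∑ _ : Fin N, 2 * ‖κ‖ ^ 2 * (powEmp 2 1 x + ‖r‖ ^ 2) := by
        gcongr with i
        refine (fluct_sq_le r _ x).trans ?_
        gcongr
        exact norm_curry_le κ (pos i)
    _ ≤ 2 * ‖κ‖ ^ 2 * (powEmp 2 1 x + ‖r‖ ^ 2) := by
        rw [Finset.sum_const, Finset.card_univ, Fintype.card_fin, nsmul_eq_mul, ← mul_assoc,
          one_div]
        exact mul_le_of_le_one_left (by positivity) (inv_mul_le_one)

theorem weightedFluct_sq_le (x : State N) :
    weightedFluct κ r f x ^ 2 ≤ ‖f‖ ^ 2 * (powEmp 2 1 x * meanSqFluct κ r x) := by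
  rw [weightedFluct, mul_pow, powEmp_one_eq, meanSqFluct_apply]
  calc (1 / N : ℝ) ^ 2 *
        (∑ i : Fin N, (x i : ℝ) * (f (pos i) * fluct r (κ.curry (pos i)) x)) ^ 2
      ≤ (1 / N : ℝ) ^ 2 * ((∑ i : Fin N, (x i : ℝ) ^ 2) *
          ∑ i : Fin N, (f (pos i) * fluct r (κ.curry (pos i)) x) ^ 2) := by
        gcongr
        exact Finset.sum_mul_sq_le_sq_mul_sq _ _ _
    _ ≤ (1 / N : ℝ) ^ 2 * ((∑ i : Fin N, (x i : ℝ) ^ 2) *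
          (‖f‖ ^ 2 * ∑ i : Fin N, fluct r (κ.curry (pos i)) x ^ 2)) := by
        rw [Finset.mul_sum _ _ (‖f‖ ^ 2)]
        gcongr with i
        rw [mul_pow, ← sq_abs (f (pos i))]
        gcongr
        exact f.norm_coe_le_norm _
    _ = _ := by ring

/-- Only the factor `ζ⁻¹` comes with `meanSqFluct`, whose expectation vanishes in the limit; the
other terms are controlled by moments and the choice of `ζ`. -/
theorem powEmp_two_mul_meanSqFluct_le {ζ : ℝ} (hζ : 0 < ζ) (x : State N) :
    powEmp 2 1 x * meanSqFluct κ r x ≤ ζ⁻¹ * meanSqFluct κ r x +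
      ζ * (2 * ‖κ‖ ^ 2 * (powEmp 8 1 x + (1 + ‖r‖ ^ 2) * powEmp 4 1 x)) := by
  set Y := powEmp 2 1 x
  have hY : 0 ≤ Y := powEmp_one_nonneg 2 x
  have hY4 : Y ^ 2 ≤ powEmp 4 1 x := powEmp_one_sq_le 2 x
  have hY8 : Y ^ 4 ≤ powEmp 8 1 x :=
    calc Y ^ 4 = (Y ^ 2) ^ 2 := by ring
      _ ≤ powEmp 4 1 x ^ 2 := by gcongr
      _ ≤ powEmp 8 1 x := powEmp_one_sq_le 4 x
  have split : Y ≤ ζ⁻¹ + ζ * Y ^ 2 := by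
    have : ζ * ζ⁻¹ = 1 := mul_inv_cancel₀ hζ.ne'
    have : 0 < ζ⁻¹ := inv_pos.2 hζ
    nlinarith [sq_nonneg (ζ * Y - 1)]
  calc Y * meanSqFluct κ r x ≤ (ζ⁻¹ + ζ * Y ^ 2) * meanSqFluct κ r x :=
        mul_le_mul_of_nonneg_right split (meanSqFluct_nonneg κ r x)
    _ = ζ⁻¹ * meanSqFluct κ r x + ζ * (Y ^ 2 * meanSqFluct κ r x) := by ring
    _ ≤ ζ⁻¹ * meanSqFluct κ r x + ζ * (Y ^ 2 * (2 * ‖κ‖ ^ 2 * (Y + ‖r‖ ^ 2))) := by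
        gcongr
        exact meanSqFluct_le κ r x
    _ = ζ⁻¹ * meanSqFluct κ r x + ζ * (2 * ‖κ‖ ^ 2 * (Y ^ 2 * Y + ‖r‖ ^ 2 * Y ^ 2)) := by ring
    _ ≤ ζ⁻¹ * meanSqFluct κ r x +
          ζ * (2 * ‖κ‖ ^ 2 * (Y ^ 2 * (Y ^ 2 + 1) + ‖r‖ ^ 2 * Y ^ 2)) := by
        gcongr
        nlinarith [sq_nonneg (Y - 1)]
    _ = ζ⁻¹ * meanSqFluct κ r x + ζ * (2 * ‖κ‖ ^ 2 * (Y ^ 4 + (1 + ‖r‖ ^ 2) * Y ^ 2)) := by ring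
    _ ≤ _ := by gcongr

end Fluctuations

section CrossTerm

variable (M : Coeffs) {N : ℕ} (f : C(I, ℝ)) (x : State N)

/-- The restriction `u ↦ k(u, u)` of a kernel to the diagonal. -/
def diagK (k : C(I × I, ℝ)) : C(I, ℝ) := k.comp ⟨fun u => (u, u), by fun_prop⟩

theorem crossTerm_one : crossTerm M 1 f x = 0 := by
  simp [crossTerm]

theorem crossKer_apply (u v : I) :
    crossKer M (u, v) = M.a₁ (u, v) * M.a₂ (u, v) * M.lam (u, v) +
      M.lam (v, u) * M.a₃ (v, u) * M.a₄ (v, u) := by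
  simp [crossKer, swapK, toR]

theorem crossTerm_two :
    crossTerm M 2 f x =
      2 * ((1 / N : ℝ) * ∑ i, (x i : ℝ) *
        (f (pos i) * powEmp 1 ((crossKer M).curry (pos i)) x)) -
      2 / N * powEmp 2 (f * diagK (crossKer M)) x := by
  let A (i j : Fin N) : ℝ := M.a₁ (pos i, pos j) * M.a₂ (pos i, pos j) * M.lam (pos i, pos j)
  let B (i j : Fin N) : ℝ := M.lam (pos i, pos j) * M.a₃ (pos i, pos j) * M.a₄ (pos i, pos j)
  have summand (i j : Fin N) : (M.lam (pos i, pos j) : ℝ) *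
      (f (pos i) * ((M.a₁ (pos i, pos j) * x i + M.a₂ (pos i, pos j) * x j) ^ 2 -
        (M.a₁ (pos i, pos j) : ℝ) ^ 2 * (x i : ℝ) ^ 2 -
        (M.a₂ (pos i, pos j) : ℝ) ^ 2 * (x j : ℝ) ^ 2) +
      f (pos j) * ((M.a₃ (pos i, pos j) * x i + M.a₄ (pos i, pos j) * x j) ^ 2 -
        (M.a₃ (pos i, pos j) : ℝ) ^ 2 * (x i : ℝ) ^ 2 -
        (M.a₄ (pos i, pos j) : ℝ) ^ 2 * (x j : ℝ) ^ 2)) =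
      2 * (x i * (f (pos i) * (x j * A i j))) + 2 * (x j * (f (pos j) * (x i * B i j))) := by
    ring
  have symmetrize : ∑ i, ∑ j, (2 * (x i * (f (pos i) * (x j * A i j))) +
      2 * (x j * (f (pos j) * (x i * B i j)))) =
      ∑ i, ∑ j, 2 * ((x i : ℝ) * (f (pos i) * (x j * crossKer M (pos i, pos j)))) := by
    simp_rw [Finset.sum_add_distrib]
    rw [Finset.sum_comm (f := fun i j => 2 * ((x j : ℝ) * (f (pos j) * (x i * B i j)))),
      ← Finset.sum_add_distrib]
    simp_rw [← Finset.sum_add_distrib]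
    refine Finset.sum_congr rfl fun i _ => Finset.sum_congr rfl fun j _ => ?_
    rw [crossKer_apply]
    ring
  simp_rw [crossTerm, summand]
  rw [sum_sum_ne, symmetrize]
  simp only [powEmp, pow_one, ContinuousMap.curry_apply, mul_sub, Finset.mul_sum]
  congr 1
  · exact Finset.sum_congr rfl fun i _ => Finset.sum_congr rfl fun j _ => by ring
  · refine Finset.sum_congr rfl fun i _ => ?_
    rw [ContinuousMap.mul_apply, show diagK (crossKer M) (pos i) = _ from crossKer_apply M _ _]
    ring

theorem densityFunctional_curry (κ : C(I × I, ℝ)) (r : C(I, ℝ)) (u : I) :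
    densityFunctional r (κ.curry u) = kernelOp κ r u := by
  simp only [densityFunctional_apply, kernelOp_apply, ContinuousMap.curry_apply, mul_comm]

theorem lOne_apply_eq (r : C(I, ℝ)) :
    lOne M r f = 2 * densityFunctional r (f * kernelOp (crossKer M) r) := by
  rw [lOne_eq, smul_apply, smul_eq_mul, densityFunctional_apply, densityFunctional_apply]
  simp only [ContinuousMap.mul_apply, mul_assoc, mul_comm (f _)]

theorem crossTerm_two_sub_lOne (r : C(I, ℝ)) :
    crossTerm M 2 f x - lOne M r f =
      2 * weightedFluct (crossKer M) r f x + 2 * fluct r (f * kernelOp (crossKer M) r) x -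
      2 / N * powEmp 2 (f * diagK (crossKer M)) x := by
  have hsplit : (1 / N : ℝ) * ∑ i, (x i : ℝ) *
        (f (pos i) * powEmp 1 ((crossKer M).curry (pos i)) x) =
      weightedFluct (crossKer M) r f x + powEmp 1 (f * kernelOp (crossKer M) r) x := by
    rw [weightedFluct, powEmp, ← mul_add, ← Finset.sum_add_distrib]
    congr 1
    refine Finset.sum_congr rfl fun i _ => ?_
    rw [fluct, densityFunctional_curry, ContinuousMap.mul_apply]
    ring
  rw [crossTerm_two, hsplit, lOne_apply_eq, fluct]
  ring

theorem abs_powEmp_mul_diagK_le (k : C(I × I, ℝ)) (p : ℕ) :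
    |powEmp p (f * diagK k) x| ≤ ‖f‖ * ‖k‖ * powEmp p 1 x := by
  refine abs_average_pow_mul_le p (fun i => ?_) x
  rw [ContinuousMap.mul_apply, abs_mul]
  exact mul_le_mul (f.norm_coe_le_norm _) (k.norm_coe_le_norm _) (abs_nonneg _) (norm_nonneg f)

end CrossTerm

theorem expect_powEmp_two_mul_meanSqFluct_le {M : Coeffs} {N : ℕ} {Ω : Type*}
    [MeasurableSpace Ω] {P : Measure Ω} [IsProbabilityMeasure P] {X : ℝ≥0 → Ω → State N}
    (hX : IsLinearSystem M N P X) (h0 : ∀ᵐ ω ∂P, ∀ i, X 0 ω i ≤ 1) (κ : C(I × I, ℝ))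
    (r : C(I, ℝ)) {ζ : ℝ} (hζ : 0 < ζ) (t : ℝ) :
    expect P X t (powEmp 2 1 * meanSqFluct κ r) ≤ ζ⁻¹ * expect P X t (meanSqFluct κ r) +
      ζ * (2 * ‖κ‖ ^ 2 * (expect P X t (powEmp 8 1) +
        (1 + ‖r‖ ^ 2) * expect P X t (powEmp 4 1))) := by
  have hD := meanSqFluct_mem_polyGrowth (N := N) κ r
  have hY (p : ℕ) := powEmp_mem_polyGrowth (N := N) p 1
  have hmom := Subalgebra.smul_mem _ (add_mem (hY 8)
    (Subalgebra.smul_mem _ (hY 4) (1 + ‖r‖ ^ 2))) (ζ * (2 * ‖κ‖ ^ 2))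
  calc expect P X t (powEmp 2 1 * meanSqFluct κ r)
      ≤ expect P X t (ζ⁻¹ • meanSqFluct κ r +
          (ζ * (2 * ‖κ‖ ^ 2)) • (powEmp 8 1 + (1 + ‖r‖ ^ 2) • powEmp 4 1)) :=
        expect_mono hX h0 (mul_mem (hY 2) hD) (add_mem (Subalgebra.smul_mem _ hD _) hmom)
          (fun x => (powEmp_two_mul_meanSqFluct_le κ r hζ x).trans_eq (by
            simp only [Pi.add_apply, Pi.smul_apply, smul_eq_mul]
            ring)) t
    _ = _ := by
        rw [expect_add hX h0 (Subalgebra.smul_mem _ hD _) hmom, expect_smul, expect_smul,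
          expect_add hX h0 (hY 8) (Subalgebra.smul_mem _ (hY 4) _), expect_smul, mul_assoc]

section LawOfLargeNumbers

variable {M : Coeffs} {φ : C(I, ℝ)} {Ω : ℕ → Type*} [∀ N, MeasurableSpace (Ω N)]
  {P : ∀ N, Measure (Ω N)} [∀ N, IsProbabilityMeasure (P N)] {X : ∀ N, ℝ≥0 → Ω N → State N}
  (hX : ∀ N, 1 ≤ N → IsLinearSystem M N (P N) (X N))

include hX in
theorem MeanSquareNegligible.gen_powEmp_sub
    (h0 : ∀ N, 1 ≤ N → ∀ᵐ ω ∂P N, ∀ i, X N 0 ω i ≤ 1) (p : ℕ) {T : ℝ} {S : Set C(I, ℝ)}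
    (hS : IsCompact S) : MeanSquareNegligible P X T S fun _ f _ x =>
      gen M (powEmp p f) x - powEmp p (driftOp M p f) x - crossTerm M p f x := by
  refine .of_abs_le hX h0 p (fun N f t => ?_) fun ε hε => ?_
  · simp only [gen_powEmp_sub_eq]
    exact average_pow_mul_mem_polyGrowth p _
  · filter_upwards [eventually_abs_gen_powEmp_sub_le M p hS hε] with N h f hf t _ x
    exact h f hf x

include hX in
theorem MeanSquareNegligible.tendsto_iSup_lintegral
    (h0 : ∀ N, 1 ≤ N → ∀ᵐ ω ∂P N, ∀ i, X N 0 ω i ≤ 1) {T : ℝ} {κ : Type*} {S : Set κ}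
    {ψ : ∀ N, κ → ℝ → State N → ℝ} (hψ : MeanSquareNegligible P X T S ψ)
    {a : Set.Icc (0 : ℝ) T → κ} (ha : ∀ t, a t ∈ S) :
    Tendsto (fun N => ⨆ t : Set.Icc (0 : ℝ) T,
      ∫⁻ ω, ENNReal.ofReal (ψ N (a t) t (X N (Real.toNNReal t) ω) ^ 2) ∂P N) atTop (𝓝 0) := by
  refine ENNReal.tendsto_nhds_zero.2 fun ε hε => ?_
  obtain ⟨δ, hδ, hδε⟩ : ∃ δ > 0, ENNReal.ofReal δ ≤ ε := by
    rcases eq_or_ne ε ⊤ with rfl | h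
    · exact ⟨1, one_pos, le_top⟩
    · exact ⟨ε.toReal, ENNReal.toReal_pos hε.ne' h, ENNReal.ofReal_toReal_le⟩
  filter_upwards [hψ.eventually_le δ hδ, eventually_ge_atTop 1] with N h hN
  refine iSup_le fun t => le_trans ?_ hδε
  have hint : Integrable (fun ω => ψ N (a t) t (X N (Real.toNNReal t) ω) ^ 2) (P N) :=
    integrable_of_mem_polyGrowth (hX N hN) (h0 N hN) (pow_mem (hψ.mem_polyGrowth N (a t) t) 2) _
  rw [← ofReal_integral_eq_lintegral_ofReal hint (.of_forall fun ω => sq_nonneg _)]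
  exact ENNReal.ofReal_le_ofReal (h _ (ha t) t t.2)

variable (hX₀ : ∀ N, 1 ≤ N → IsInitialState φ N (P N) (X N 0))
  {ρ : ℝ → C(I, ℝ)} (hρ : IsHydroDensity M φ ρ) {T : ℝ}

include hX hX₀

theorem eventually_expect_powEmp_sub_sq_le {p : ℕ} (hp : p ≠ 0) {S : Set C(I, ℝ)}
    (hS : IsCompact S) {ε : ℝ} (hε : 0 < ε) : ∀ᶠ N in atTop, ∀ f ∈ S,
      expect (P N) (X N) 0 (fun x => (powEmp p f x - densityFunctional φ f) ^ 2) ≤ ε := by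
  simpa only [expect, Real.toNNReal_zero] using
    eventually_integral_powEmp_sub_sq_le (fun N hN => (hX N hN).measurable 0) hX₀ hp hS hε

theorem ae_initial_le_one (N : ℕ) (hN : 1 ≤ N) : ∀ᵐ ω ∂P N, ∀ i, X N 0 ω i ≤ 1 :=
  (hX₀ N hN).ae_le_one ((hX N hN).measurable 0)

include hρ

theorem MeanSquareNegligible.fluct {S : Set C(I, ℝ)} (hS : IsCompact S) :
    MeanSquareNegligible P X T S fun _ f t => fluct (ρ t) f := by
  refine .powEmp_sub hX (ae_initial_le_one hX hX₀) 1 (A := driftOp M 1) (h := 0)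
    (fun s hs => ?_) (fun S hS ε hε => ?_) (fun S hS => ?_) hS
  · have hd : adj (driftOp M 1) (densityFunctional (ρ s)) = densityFunctional (hydroOp M (ρ s)) :=
      ContinuousLinearMap.ext fun f => densityFunctional_driftOp_one M (ρ s) f
    rw [Pi.zero_apply, add_zero, hd]
    exact hasDerivWithinAt_densityFunctional ((hρ.2 s hs.1).mono Set.Icc_subset_Ici_self)
  · rw [hρ.1]
    exact eventually_expect_powEmp_sub_sq_le hX hX₀ one_ne_zero hS hε
  · simpa only [crossTerm_one, Pi.zero_apply, zero_apply] using
      MeanSquareNegligible.gen_powEmp_sub hX (ae_initial_le_one hX hX₀) 1 hS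

theorem eventually_expect_meanSqFluct_le (κ : C(I × I, ℝ)) {ε : ℝ} (hε : 0 < ε) :
    ∀ᶠ N in atTop, ∀ t ∈ Set.Icc 0 T, expect (P N) (X N) t (meanSqFluct κ (ρ t)) ≤ ε := by
  have hlln := MeanSquareNegligible.fluct hX hX₀ hρ (T := T) (isCompact_range κ.curry.continuous)
  filter_upwards [hlln.eventually_le ε hε, eventually_ge_atTop 1] with N h hN t ht
  rw [meanSqFluct, expect_smul, expect_sum (hX N hN) (ae_initial_le_one hX hX₀ N hN) _
    (fun i _ => pow_mem (fluct_mem_polyGrowth _ _) 2)]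
  calc (1 / N : ℝ) * ∑ i : Fin N, expect (P N) (X N) t (NUrn.fluct (ρ t) (κ.curry (pos i)) ^ 2)
      ≤ (1 / N : ℝ) * ∑ _ : Fin N, ε := by
        gcongr with i
        exact h _ ⟨pos i, rfl⟩ t ht
    _ = ε := by
        have : (N : ℝ) ≠ 0 := by exact_mod_cast Nat.one_le_iff_ne_zero.1 hN
        rw [Finset.sum_const, Finset.card_univ, Fintype.card_fin, nsmul_eq_mul]
        field_simp

theorem eventually_expect_powEmp_two_mul_meanSqFluct_le (κ : C(I × I, ℝ)) {ε : ℝ} (hε : 0 < ε) :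
    ∀ᶠ N in atTop, ∀ t ∈ Set.Icc 0 T,
      expect (P N) (X N) t (powEmp 2 1 * meanSqFluct κ (ρ t)) ≤ ε := by
  have h0 := ae_initial_le_one hX hX₀
  obtain ⟨W, hW, hρW⟩ := exists_pos_norm_bound
    (isCompact_Icc.image_of_continuousOn
      (hρ.continuousOn.mono (Set.Icc_subset_Ici_self : Set.Icc 0 T ⊆ _)))
  obtain ⟨C₈, hC₈, h₈⟩ := exists_expect_powEmp_one_le hX h0 8 T
  obtain ⟨C₄, hC₄, h₄⟩ := exists_expect_powEmp_one_le hX h0 4 T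
  set C := 2 * ‖κ‖ ^ 2 * (C₈ + (1 + W ^ 2) * C₄) with hC
  obtain ⟨ζ, hζ, hζε⟩ : ∃ ζ > 0, ζ * C ≤ ε / 2 :=
    ⟨ε / 2 / (C + 1), by positivity, by
      rw [div_mul_eq_mul_div, div_le_iff₀ (by positivity)]
      linarith⟩
  filter_upwards [eventually_expect_meanSqFluct_le hX hX₀ hρ κ (by positivity : 0 < ζ * (ε / 2)),
    eventually_ge_atTop 1] with N h hN t ht
  have hρt : ‖ρ t‖ ≤ W := hρW _ ⟨t, ht, rfl⟩
  have hY4 : 0 ≤ expect (P N) (X N) t (powEmp 4 1) :=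
    integral_nonneg fun ω => powEmp_one_nonneg 4 _
  calc expect (P N) (X N) t (powEmp 2 1 * meanSqFluct κ (ρ t))
      ≤ ζ⁻¹ * expect (P N) (X N) t (meanSqFluct κ (ρ t)) + ζ * (2 * ‖κ‖ ^ 2 *
          (expect (P N) (X N) t (powEmp 8 1) +
            (1 + ‖ρ t‖ ^ 2) * expect (P N) (X N) t (powEmp 4 1))) :=
        expect_powEmp_two_mul_meanSqFluct_le (hX N hN) (h0 N hN) κ (ρ t) hζ t
    _ ≤ ζ⁻¹ * (ζ * (ε / 2)) + ζ * (2 * ‖κ‖ ^ 2 * (C₈ + (1 + W ^ 2) * C₄)) := by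
        gcongr
        · exact h t ht
        · exact h₈ N hN t ht
        · exact h₄ N hN t ht
    _ ≤ ε := by
        rw [inv_mul_cancel_left₀ hζ.ne', ← hC]
        linarith

theorem MeanSquareNegligible.weightedFluct (κ : C(I × I, ℝ)) {S : Set C(I, ℝ)} (hS : IsCompact S) :
    MeanSquareNegligible P X T S fun _ f t => weightedFluct κ (ρ t) f := by
  obtain ⟨R, hR, hSR⟩ := exists_pos_norm_bound hS
  refine .of_sq_le hX (ae_initial_le_one hX hX₀)
    (fun N f t => weightedFluct_mem_polyGrowth κ (ρ t) f)
    (B := fun N f t => R ^ 2 • (powEmp 2 1 * meanSqFluct κ (ρ t)))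
    (fun N f t => Subalgebra.smul_mem _ (mul_mem (powEmp_mem_polyGrowth 2 1)
      (meanSqFluct_mem_polyGrowth κ (ρ t))) _) fun ε hε => ?_
  filter_upwards [eventually_expect_powEmp_two_mul_meanSqFluct_le hX hX₀ hρ κ (T := T)
    (by positivity : 0 < ε / R ^ 2)] with N h f hf t ht
  refine ⟨fun x => (weightedFluct_sq_le κ (ρ t) f x).trans ?_, ?_⟩
  · have := mul_nonneg (powEmp_one_nonneg 2 x) (meanSqFluct_nonneg κ (ρ t) x)
    have := hSR f hf
    simp only [Pi.smul_apply, Pi.mul_apply, smul_eq_mul]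
    gcongr
  · rw [expect_smul]
    exact (le_div_iff₀' (by positivity)).1 (h t ht)

theorem MeanSquareNegligible.crossTerm_two_sub_lOne {S : Set C(I, ℝ)} (hS : IsCompact S) :
    MeanSquareNegligible P X T S fun _ f t x => crossTerm M 2 f x - lOne M (ρ t) f := by
  have h0 := ae_initial_le_one hX hX₀
  obtain ⟨R, _, hSR⟩ := exists_pos_norm_bound hS
  have hS' : IsCompact ((fun z : ℝ × C(I, ℝ) => z.2 * kernelOp (crossKer M) (ρ z.1)) ''
      (Set.Icc 0 T ×ˢ S)) := by
    refine (isCompact_Icc.prod hS).image_of_continuousOn (continuousOn_snd.mul ?_)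
    exact (kernelOp (crossKer M)).continuous.comp_continuousOn
      ((hρ.continuousOn.mono Set.Icc_subset_Ici_self).comp continuousOn_fst fun z hz => hz.1)
  have h_weighted := MeanSquareNegligible.weightedFluct hX hX₀ hρ (T := T) (crossKer M) hS
  have h_fluct := (MeanSquareNegligible.fluct hX hX₀ hρ (T := T) hS').reindex (S := S)
    (τ := fun f t => f * kernelOp (crossKer M) (ρ t)) fun f hf t ht => ⟨(t, f), ⟨ht, hf⟩, rfl⟩
  have h_diag : MeanSquareNegligible P X T S fun N f _ =>
      (-(2 / N : ℝ)) • powEmp 2 (f * diagK (crossKer M)) := by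
    refine .of_abs_le hX h0 2
      (fun N f _ => Subalgebra.smul_mem _ (powEmp_mem_polyGrowth 2 _) _) fun ε hε => ?_
    filter_upwards [eventually_div_le (2 * (R * ‖crossKer M‖)) hε] with N hN f hf t _ x
    have := powEmp_one_nonneg 2 x
    calc |-(2 / N : ℝ) * powEmp 2 (f * diagK (crossKer M)) x|
        = 2 / N * |powEmp 2 (f * diagK (crossKer M)) x| := by
          rw [abs_mul, abs_neg, abs_of_nonneg (by positivity)]
      _ ≤ 2 / N * (R * ‖crossKer M‖ * powEmp 2 1 x) := by
          gcongr
          refine (abs_powEmp_mul_diagK_le f x (crossKer M) 2).trans ?_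
          gcongr
          exact hSR f hf
      _ = 2 * (R * ‖crossKer M‖) / N * powEmp 2 1 x := by ring
      _ ≤ ε * powEmp 2 1 x := by gcongr
  have h_sum := ((h_weighted.const_smul 2).add hX h0 (h_fluct.const_smul 2)).add hX h0 h_diag
  refine cast (congrArg _ ?_) h_sum
  funext N f t x
  simp only [Pi.add_apply, Pi.smul_apply, smul_eq_mul]
  rw [NUrn.crossTerm_two_sub_lOne]
  ring

theorem MeanSquareNegligible.powEmp_two_sub {θ : ℝ → StrongDual ℝ C(I, ℝ)}
    (hθ : IsThetaSolution M φ ρ T θ) {S : Set C(I, ℝ)} (hS : IsCompact S) :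
    MeanSquareNegligible P X T S fun _ f t x => powEmp 2 f x - θ t f := by
  have h0 := ae_initial_le_one hX hX₀
  refine .powEmp_sub hX h0 2 hθ.2 (fun S hS ε hε => ?_) (fun S hS => ?_) hS
  · rw [hθ.1]
    exact eventually_expect_powEmp_sub_sq_le hX hX₀ two_ne_zero hS hε
  · have h_gen := MeanSquareNegligible.gen_powEmp_sub hX h0 2 hS (T := T)
    have h_cross := MeanSquareNegligible.crossTerm_two_sub_lOne hX hX₀ hρ hS (T := T)
    refine cast (congrArg _ ?_) (h_gen.add hX h0 h_cross)
    funext N f t x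
    rw [Pi.add_apply, driftOp_two]
    ring

end LawOfLargeNumbers

end NUrn

end

theorem lemma2p3 (M : NUrn.Coeffs) (φ : C(I, ℝ))
    {Ω : ℕ → Type*} [∀ N, MeasurableSpace (Ω N)] (P : ∀ N, Measure (Ω N))
    [∀ N, IsProbabilityMeasure (P N)] (X : ∀ N, ℝ≥0 → Ω N → NUrn.State N)
    (hX : ∀ N, 1 ≤ N → NUrn.IsLinearSystem M N (P N) (X N))
    (hX₀ : ∀ N, 1 ≤ N → NUrn.IsInitialState φ N (P N) (X N 0))
    (T : ℝ) (hT : 0 < T) :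
    -- the unique solution `ρ` of the hydrodynamic equation
    ∃ ρ : ℝ → C(I, ℝ), NUrn.IsHydroDensity M φ ρ ∧
      (∀ ρ', NUrn.IsHydroDensity M φ ρ' → Set.EqOn ρ' ρ (Set.Ici 0)) ∧
      -- the unique solution `θ` of the equation driven by `P₂^*` and `l_{1,t}`
      ∃ θ : ℝ → StrongDual ℝ C(I, ℝ), NUrn.IsThetaSolution M φ ρ T θ ∧
        (∀ θ', NUrn.IsThetaSolution M φ ρ T θ' → Set.EqOn θ' θ (Set.Icc 0 T)) ∧
        -- convergence in `L²`, uniformly in `t ∈ [0, T]`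
        (∀ H : C(Set.Icc (0 : ℝ) T × I, ℝ),
          Tendsto (fun N => ⨆ t : Set.Icc (0 : ℝ) T,
            ∫⁻ ω, ENNReal.ofReal
              ((NUrn.sqEmpirical (X N (Real.toNNReal t) ω) (H.curry t)
                - θ t (H.curry t)) ^ 2) ∂(P N)) atTop (𝓝 0)) ∧
        -- `θ_t` has a jointly continuous density
        ∃ ϑ : C(Set.Icc (0 : ℝ) T × I, ℝ),
          ∀ t : Set.Icc (0 : ℝ) T, θ t = NUrn.densityFunctional (ϑ.curry t) := by
  open NUrn in
  obtain ⟨ρ, hρ, hρc⟩ := exists_isHydroDensity M φ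
  obtain ⟨y, hθ, hyc⟩ := exists_isThetaSolution_densityFunctional M φ hρc T
  refine ⟨ρ, hρ, fun ρ' h' => h'.eqOn hρ, fun t => densityFunctional (y t), hθ,
    fun θ' h' => h'.eqOn hθ, fun H => ?_,
    ContinuousMap.uncurry ⟨fun t => y t, hyc.comp continuous_subtype_val⟩, fun t => rfl⟩
  have hlln := MeanSquareNegligible.powEmp_two_sub hX hX₀ hρ hθ
    (isCompact_range H.curry.continuous)
  have hlim := hlln.tendsto_iSup_lintegral hX (ae_initial_le_one hX hX₀)
    (a := H.curry) fun t => ⟨t, rfl⟩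
  simpa only [sqEmpirical_apply, powEmp] using hlim
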